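/- nother choice only relabels the operations, so the multisets do not change./ **Theorem (Finite $N$ master loop equation).** nother choice only relabels the operations, so the multisets do not change./ nother choice only relabels the operations, so the multisets do not change./ *Lattice and loops.* Let $d\ge 2$ and let $E$ be the set of directed nearest neighbour edges of $\mathbb{Z}^d$; an edge is positively oriented if its ending point is lexicographically greater than its beginning point, and $e^{-1}$ denotes the reversal of $e$. A closed path is a finite (possibly empty) sequence of edges $e_1\cdots e_n$ in which each edge ends where the next one begins, cyclically; its inverse is $e_n^{-1}\cdots e_1^{-1}$. A cycle is a class of closed paths up to cyclic permutation. A backtrack is a pair of cyclically consecutive edges $e,e^{-1}$. A loop is a cycle without backtracks (the empty one is the null loop), and for a cycle $c$ its core $[c]$ is the unique loop obtained from $c$ by erasing backtracks successively. A plaquette is a nonbacktracking closed path of length four; $e_1e_2e_3e_4$ is positively oriented if the beginning point of $e_1$ is lexicographically the smallest of its vertices and the ending point of $e_1$ the second smallest. $\mathcal{P}^+(e)$ is the set of positively oriented plaquettes containing $e$ or $e^{-1}$. Fix for each loop a first edge, by an arbitrary rule; the location $k$ then refers to its $k$-th edge. nother choice only relabels the operations, so the multisets do not change./ nother choice only relabels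 the operations, so the multisets do not change./ A loop sequence $s$ is a finite sequence of loops, two sequences being identified if they differ only by insertion and deletion of null loops; its minimal representation $(l_1,\dots,l_n)$ is the one without null loops, and $|s|=|l_1|+\cdots+|l_n|$, where $|l|$ is the number of edges of $l$. nother choice only relabels the operations, so the multisets do not change./ nother choice only relabels the operations, so the multisets do not change./ *Operations.* Below, $a,b,c,d$ are paths, and a loop is written as a word up to cyclic permutation. nother choice only relabels the operations, so the multisets do not change./ - Mergers of $l$ at location $x$ and $l'$ at location $y$: if $l=aeb$ and $l'=ced$ (with $e$ at $x$ and at $y$), the positive merger is $[aedceb]$ and the negative one is $[ac^{-1}d^{-1}b]$; if $l=aeb$, $l'=ce^{-1}d$, the positive merger is $[aec^{-1}d^{-1}eb]$ and the negative one is $[adcb]$. nother choice only relabels the operations, so the multisets do not change./ - A positive/negative deformation of $l$ at location $x$ with edge $e$ is the positive/negative merger of $l$ at $x$ with a plaquette $p\in\mathcal{P}^+(e)$ at the unique location of $e$ or $e^{-1}$ in $p$. nother choice only relabels the operations, so the multisets do not change./ - Splittings of $l$ at distinct locations $x,y$: if $l=aebec$ (with $e$ at $x$ and at $y$), the positive splitting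 is the pair $[aec],[be]$; if $l=aebe^{-1}c$, the negative splitting is the pair $[ac],[b]$. nother choice only relabels the operations, so the multisets do not change./ - Twistings of $l$ at distinct locations $x,y$: if $l=aebec$, the negative twisting is $[ab^{-1}c]$; if $l=aebe^{-1}c$, the positive twisting is $[aeb^{-1}e^{-1}c]$. nother choice only relabels the operations, so the multisets do not change./ nother choice only relabels the operations, so the multisets do not change./ For a loop sequence $s$ with minimal representation $(l_1,\dots,l_n)$, let $\mathbb{T}^\pm(s)$, $\mathbb{S}^\pm(s)$ and $\mathbb{D}^\pm(s)$ be the collections of loop sequences obtained by replacing one component $l_k$ by a positive/negative twisting, by the (ordered) pair of loops of a positive/negative splitting, or by a positive/negative deformation of it, and $\mathbb{M}^\pm(s)$ the collection obtained by replacing some $l_k$ by its positive/negative merger with some $l_r$, $r\neq k$, and removing $l_r$. These collections are counted with multiplicity: every admissible choice of the component $k$ (of the ordered pair $(k,r)$ for mergers), of the location $x$ or the ordered pair of locations $(x,y)$, and of the plaquette $p$ for deformations, contributes one element. nother choice only relabels the operations, so the multisets do not change./ nother choice only relabels the operations, so the multisets do not change./ *Gauge theory.* Let $\Lambda\subseteq\mathbb{Z}^d$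 be finite and nonempty, $N\ge 2$ an integer and $\beta$ a real number. Let $E_\Lambda^+$ be the set of positively oriented edges with both end points in $\Lambda$, and $\mathcal{P}^+_\Lambda$ the set of positively oriented plaquettes with all vertices in $\Lambda$. For $Q=(Q_e)_{e\in E^+_\Lambda}\in SO(N)^{E_\Lambda^+}$ put $Q_{e^{-1}}:=Q_e^{-1}$, and $Q_p:=Q_{e_1}Q_{e_2}Q_{e_3}Q_{e_4}$ for $p=e_1e_2e_3e_4$. Let $\langle\cdot\rangle$ denote expectation under the probability measure nother choice only relabels the operations, so the multisets do not change./ $$d\mu_{\Lambda,N,\beta}(Q)=Z_{\Lambda,N,\beta}^{-1}\exp\Bigl(N\beta\sum_{p\in\mathcal{P}^+_\Lambda}\operatorname{Tr}(Q_p)\Bigr)\prod_{e\in E^+_\Lambda}d\sigma_N(Q_e),$$ nother choice only relabels the operations, so the multisets do not change./ where $\sigma_N$ is the normalized Haar measure on $SO(N)$ and $Z_{\Lambda,N,\beta}$ is the normalizing constant. For a loop $l=e_1\cdots e_m$ in $\Lambda$ let $W_l:=\operatorname{Tr}(Q_{e_1}\cdots Q_{e_m})$, and for a loop sequence $s$ with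 minimal representation $(l_1,\dots,l_n)$ whose loops lie in $\Lambda$ let nother choice only relabels the operations, so the multisets do not change./ $$\phi(s):=\frac{\langle W_{l_1}W_{l_2}\cdots W_{l_n}\rangle}{N^n}$$ nother choice only relabels the operations, so the multisets do not change./ (so $\phi=1$ for the null loop sequence). nother choice only relabels the operations, so the multisets do not change./ nother choice only relabels the operations, so the multisets do not change./ *Claim.* Let $s$ be a non-null loop sequence with minimal representation $(l_1,\dots,l_n)$ such that all points of $\mathbb{Z}^d$ at lattice distance $\le 1$ from a vertex of some $l_i$ belong to $\Lambda$. Then nother choice only relabels the operations, so the multisets do not change./ $$\begin{aligned}(N-1)|s|\phi(s)=&\sum_{s'\in\mathbb{T}^-(s)}\phi(s')-\sum_{s'\in\mathbb{T}^+(s)}\phi(s')+N\sum_{s'\in\mathbb{S}^-(s)}\phi(s')-N\sum_{s'\in\mathbb{S}^+(s)}\phi(s')\\&+\frac1N\sum_{s'\in\mathbb{M}^-(s)}\phi(s')-\frac1N\sum_{s'\in\mathbb{M}^+(s)}\phi(s')+N\beta\sum_{s'\in\mathbb{D}^-(s)}\phi(s')-N\beta\sum_{s'\in\mathbb{D}^+(s)}\phi(s').\end{aligned}$$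 nother choice only relabels the operations, so the multisets do not change./ -/

import Mathlib

open MeasureTheory

namespace LatticeGauge

/-! ### The lattice, paths and cycles -/

/-- A directed nearest neighbour edge of `ℤ^d`, with beginning point `src` and ending point `tgt`. -/
@[ext] structure Edge (d : ℕ) where
  src : Fin d → ℤ
  tgt : Fin d → ℤ
  adj : ∑ i, |tgt i - src i| = 1

/-- The same edge with the opposite direction. -/
instance {d : ℕ} : Inv (Edge d) :=
  ⟨fun e => ⟨e.tgt, e.src, by simpa only [abs_sub_comm] using e.adj⟩⟩

theorem Edge.inv_inv {d : ℕ} (e : Edge d) : e⁻¹⁻¹ = e := rfl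

/-- The ending point is lexicographically greater than the beginning point. -/
def Edge.IsPos {d : ℕ} (e : Edge d) : Prop := toLex e.src < toLex e.tgt

/-- The inverse `e_n⁻¹ ⋯ e_1⁻¹` of the path `e_1 ⋯ e_n`. -/
def pathInv {d : ℕ} (ρ : List (Edge d)) : List (Edge d) := (ρ.map (·⁻¹)).reverse

/-- `c`, a cyclic word of edges `e_1 ⋯ e_n`, is a cycle of closed paths:
`v(e_i) = u(e_{i+1})` for all `i`, cyclically.  A closed path is a list `ρ` of edges such that
`IsClosed (ρ : Cycle (Edge d))`; the type `Cycle` is lists up to cyclic permutation. -/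
def IsClosed {d : ℕ} (c : Cycle (Edge d)) : Prop := c.Chain fun e f => e.tgt = f.src

/-- `c'` is obtained from `c` by erasing one backtrack, that is, two cyclically consecutive
edges `e, e⁻¹`. -/
def Erase {d : ℕ} (c c' : Cycle (Edge d)) : Prop :=
  ∃ (e : Edge d) (ρ : List (Edge d)), c = ↑(e :: e⁻¹ :: ρ) ∧ c' = ↑ρ

/-- There is no backtrack. -/
def IsNonbacktracking {d : ℕ} (c : Cycle (Edge d)) : Prop := ∀ c', ¬ Erase c c'

theorem exists_core {d : ℕ} (c : Cycle (Edge d)) :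
    ∃ c', Relation.ReflTransGen Erase c c' ∧ IsNonbacktracking c' := by
  induction h : c.length using Nat.strong_induction_on generalizing c with
  | _ n ih =>
    by_cases hc : IsNonbacktracking c
    · exact ⟨c, .refl, hc⟩
    · simp only [IsNonbacktracking, not_forall, not_not] at hc
      obtain ⟨c₁, h₁⟩ := hc
      have hlt : c₁.length < n := by
        obtain ⟨e, ρ, rfl, rfl⟩ := h₁
        simp only [Cycle.length_coe, List.length_cons] at h ⊢
        omega
      obtain ⟨c', h₂, h₃⟩ := ih _ hlt c₁ rfl
      exact ⟨c', .head h₁ h₂, h₃⟩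

/-- The nonbacktracking core `[c]`: the cycle without backtracks that results from erasing
backtracks successively.  It does not depend on the choices, see `eq_core`. -/
noncomputable def core {d : ℕ} (c : Cycle (Edge d)) : Cycle (Edge d) :=
  Classical.choose (exists_core c)

theorem core_spec {d : ℕ} (c : Cycle (Edge d)) :
    Relation.ReflTransGen Erase c (core c) ∧ IsNonbacktracking (core c) :=
  Classical.choose_spec (exists_core c)

theorem erase_diamond {d : ℕ} {c c₁ c₂ : Cycle (Edge d)} (h₁ : Erase c c₁) (h₂ : Erase c c₂) :
    c₁ = c₂ ∨ ∃ c₃, Erase c₁ c₃ ∧ Erase c₂ c₃ := by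
  obtain ⟨e, a, rfl, rfl⟩ := h₁
  obtain ⟨f, b, h, rfl⟩ := h₂
  rw [Cycle.coe_eq_coe] at h
  obtain ⟨n, hn, h⟩ := List.isRotated_iff_mod.1 h
  rw [List.rotate_eq_drop_append_take hn] at h
  match n, hn, h with
  | 0, _, h =>
    simp only [List.drop_zero, List.take_zero, List.append_nil, List.cons.injEq] at h
    exact Or.inl (by rw [h.2.2])
  | 1, _, h =>
    simp only [List.drop_succ_cons, List.drop_zero, List.take_succ_cons, List.take_zero,
      List.cons_append, List.cons.injEq] at h
    obtain ⟨rfl, h⟩ := h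
    rw [Edge.inv_inv] at h
    left
    cases a with
    | nil =>
      simp only [List.nil_append, List.cons.injEq] at h
      rw [← h.2]
    | cons g a =>
      simp only [List.cons_append, List.cons.injEq] at h
      obtain ⟨rfl, rfl⟩ := h
      exact Cycle.coe_cons_eq_coe_append a g
  | m + 2, _, h =>
    simp only [List.drop_succ_cons, List.take_succ_cons] at h
    obtain ⟨u, v, hu, hv⟩ : ∃ u v, a.take m = u ∧ a.drop m = v := ⟨_, _, rfl, rfl⟩
    rw [← List.take_append_drop m a]
    rw [hu, hv] at h ⊢
    match v, h with
    | [], h =>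
      simp only [List.nil_append, List.cons.injEq] at h
      left
      rw [List.append_nil, h.2.2]
    | [g], h =>
      simp only [List.cons_append, List.nil_append, List.cons.injEq] at h
      obtain ⟨rfl, rfl, rfl⟩ := h
      left
      rw [Edge.inv_inv]
      exact (Cycle.coe_cons_eq_coe_append u g).symm
    | g :: g' :: v, h =>
      simp only [List.cons_append, List.cons.injEq] at h
      obtain ⟨rfl, rfl, rfl⟩ := h
      right
      refine ⟨↑(v ++ u), ⟨g, v ++ u, ?_, rfl⟩, ⟨e, u ++ v, ?_, ?_⟩⟩
      · rw [Cycle.coe_eq_coe]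
        exact List.isRotated_append (l := u) (l' := g :: g⁻¹ :: v)
      · rw [Cycle.coe_eq_coe]
        exact (List.isRotated_append (l := v) (l' := e :: e⁻¹ :: u)).symm.symm
      · rw [Cycle.coe_eq_coe]
        exact List.isRotated_append

/-- Uniqueness of the nonbacktracking core. -/
theorem eq_core {d : ℕ} {c c' : Cycle (Edge d)} (h : Relation.ReflTransGen Erase c c')
    (h' : IsNonbacktracking c') : c' = core c := by
  obtain ⟨c₁, h₁, h₂⟩ := Relation.church_rosser (r := Erase) (fun a b c hb hc => by
    rcases erase_diamond hb hc with rfl | ⟨x, hx, hx'⟩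
    · exact ⟨b, .refl, .refl⟩
    · exact ⟨x, .single hx, .single hx'⟩) h (core_spec c).1
  have key : ∀ {x y : Cycle (Edge d)}, IsNonbacktracking x →
      Relation.ReflTransGen Erase x y → x = y := fun hx hxy => by
    rcases hxy.cases_head with h | ⟨z, hz, _⟩
    · exact h
    · exact absurd hz (hx z)
  rw [key h' h₁, key (core_spec c).2 h₂]

/-- The list of edges is a path from `u` to `v`. -/
def IsPathFromTo {d : ℕ} (u v : Fin d → ℤ) : List (Edge d) → Prop
  | [] => u = v
  | e :: ρ => e.src = u ∧ IsPathFromTo e.tgt v ρ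

theorem isPathFromTo_append {d : ℕ} {u v : Fin d → ℤ} {ρ ρ' : List (Edge d)} :
    IsPathFromTo u v (ρ ++ ρ') ↔ ∃ w, IsPathFromTo u w ρ ∧ IsPathFromTo w v ρ' := by
  induction ρ generalizing u with
  | nil => simp [IsPathFromTo]
  | cons e ρ ih => simp [IsPathFromTo, ih, and_assoc]

theorem IsPathFromTo.append {d : ℕ} {u v w : Fin d → ℤ} {ρ ρ' : List (Edge d)}
    (h : IsPathFromTo u w ρ) (h' : IsPathFromTo w v ρ') : IsPathFromTo u v (ρ ++ ρ') :=
  isPathFromTo_append.2 ⟨w, h, h'⟩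

theorem IsPathFromTo.inv {d : ℕ} {u v : Fin d → ℤ} {ρ : List (Edge d)}
    (h : IsPathFromTo u v ρ) : IsPathFromTo v u (pathInv ρ) := by
  induction ρ generalizing u with
  | nil => exact Eq.symm h
  | cons e ρ ih =>
    obtain ⟨rfl, h⟩ := h
    simp only [pathInv, List.map_cons, List.reverse_cons]
    exact (ih h).append ⟨rfl, rfl⟩

theorem isClosed_cons {d : ℕ} {e : Edge d} {ρ : List (Edge d)} :
    IsClosed (↑(e :: ρ) : Cycle (Edge d)) ↔ IsPathFromTo e.tgt e.src ρ := by
  have key : ∀ (e f : Edge d), List.IsChain (fun e f : Edge d => e.tgt = f.src) (e :: (ρ ++ [f])) ↔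
      IsPathFromTo e.tgt f.src ρ := by
    induction ρ with
    | nil => intro e f; simp [IsPathFromTo]
    | cons g ρ ih =>
      intro e f
      rw [List.cons_append, List.isChain_cons_cons, ih, IsPathFromTo, eq_comm (a := e.tgt)]
  rw [IsClosed, Cycle.chain_coe_cons, key]

theorem IsPathFromTo.isClosed {d : ℕ} {u : Fin d → ℤ} {ρ : List (Edge d)}
    (h : IsPathFromTo u u ρ) : IsClosed (ρ : Cycle (Edge d)) := by
  cases ρ with
  | nil => exact Cycle.Chain.nil _
  | cons e ρ =>
    obtain ⟨rfl, h⟩ := h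
    exact isClosed_cons.2 h

theorem IsClosed.core {d : ℕ} {c : Cycle (Edge d)} (h : IsClosed c) : IsClosed (core c) := by
  have key : ∀ c', Relation.ReflTransGen Erase c c' → IsClosed c' := by
    intro c' hc
    induction hc with
    | refl => exact h
    | tail _ h₂ ih =>
      obtain ⟨e, ρ, rfl, rfl⟩ := h₂
      obtain ⟨-, h'⟩ := isClosed_cons.1 ih
      exact IsPathFromTo.isClosed h'
  exact key _ (core_spec c).1

/-! ### Loops and loop sequences -/

/-- A loop: a nonbacktracking cycle. -/
def Loop (d : ℕ) : Type := {c : Cycle (Edge d) // IsClosed c ∧ IsNonbacktracking c}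

/-- The null loop. -/
def Loop.null (d : ℕ) : Loop d :=
  ⟨Cycle.nil, Cycle.Chain.nil _, by
    rintro c' ⟨e, ρ, h, -⟩
    exact absurd ((Cycle.coe_eq_nil _).1 h.symm) (by simp)⟩

/-- The number of edges. -/
def Loop.length {d : ℕ} (l : Loop d) : ℕ := l.1.length

/-- The vertices visited by a loop. -/
def Loop.vertices {d : ℕ} (l : Loop d) : Set (Fin d → ℤ) :=
  {v | ∃ e ∈ l.1, v = e.src ∨ v = e.tgt}

/-- The closed path obtained from a loop by declaring one of its edges, selected by an arbitrary
rule, to be the first one.  The locations in `l` are the indices of this list. -/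
noncomputable def Loop.path {d : ℕ} (l : Loop d) : List (Edge d) := Quotient.out l.1

theorem Loop.coe_path {d : ℕ} (l : Loop d) : (l.path : Cycle (Edge d)) = l.1 := Quotient.out_eq _

/-- The loop `[ρ]`, for a closed path `ρ`. -/
noncomputable def coreLoop {d : ℕ} (ρ : List (Edge d)) (h : IsClosed (ρ : Cycle (Edge d))) :
    Loop d :=
  ⟨core ρ, h.core, (core_spec _).2⟩

open scoped Classical in
/-- Delete the null loops from a finite sequence of loops. -/
noncomputable def dropNull {d : ℕ} (L : List (Loop d)) : List (Loop d) :=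
  L.filter (· ≠ Loop.null d)

/-- Two finite sequences of loops are equivalent if they differ only by null loops. -/
instance loopSeqSetoid (d : ℕ) : Setoid (List (Loop d)) where
  r L L' := dropNull L = dropNull L'
  iseqv := ⟨fun _ => rfl, fun h => h.symm, fun h h' => h.trans h'⟩

/-- Loop sequences. -/
def LoopSeq (d : ℕ) : Type := Quotient (loopSeqSetoid d)

/-- The loop sequence represented by `(l_1, …, l_n)`. -/
def LoopSeq.mk {d : ℕ} (L : List (Loop d)) : LoopSeq d := Quotient.mk _ L

/-- The null loop sequence. -/
def LoopSeq.null (d : ℕ) : LoopSeq d := LoopSeq.mk [Loop.null d]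

/-- The minimal representation: the representative without null loops. -/
noncomputable def LoopSeq.minRep {d : ℕ} (s : LoopSeq d) : List (Loop d) :=
  Quotient.lift dropNull (fun _ _ h => h) s

/-- The length `|s|`. -/
noncomputable def LoopSeq.length {d : ℕ} (s : LoopSeq d) : ℕ := (s.minRep.map Loop.length).sum

/-! ### Operations on loops

A closed path is a list `ρ` and a location in it is `x : Fin ρ.length`.  Cyclic words are written
starting from location `x`: if `ρ = a e b` with `e` at location `x`, then the cycle of `ρ` is that
of `e (b a)`, and `b a = arc ρ x x`.  If `ρ = a e b f c` with `e` at `x` and `f` at `y`, then the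
cycle of `ρ` is that of `e b f (c a)`, where `b = arc ρ x y` and `c a = arc ρ y x`.  This also
covers the case that location `y` precedes location `x`. -/

/-- The edges strictly between location `x` and the next visit to location `y`, in cyclic order. -/
def arc {d : ℕ} (ρ : List (Edge d)) (x y : ℕ) : List (Edge d) :=
  if x < y then (ρ.drop (x + 1)).take (y - (x + 1)) else ρ.drop (x + 1) ++ ρ.take y

theorem coe_eq_arc {d : ℕ} (ρ : List (Edge d)) (x : Fin ρ.length) :
    (ρ : Cycle (Edge d)) = ↑(ρ[x] :: arc ρ x x) := by
  rw [Cycle.coe_eq_coe]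
  have h : ρ = ρ.take x ++ (ρ[x] :: ρ.drop (x + 1)) := by
    rw [Fin.getElem_fin, List.getElem_cons_drop, List.take_append_drop]
  have h' : ρ[x] :: arc ρ x x = (ρ[x] :: ρ.drop (x + 1)) ++ ρ.take x := by
    rw [arc, if_neg (lt_irrefl _), List.cons_append]
  rw [h']
  conv_lhs => rw [h]
  exact List.isRotated_append

theorem coe_eq_arc_arc {d : ℕ} (ρ : List (Edge d)) (x y : Fin ρ.length) (h : x ≠ y) :
    (ρ : Cycle (Edge d)) = ↑(ρ[x] :: (arc ρ x y ++ ρ[y] :: arc ρ y x)) := by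
  have aux : ∀ x y : Fin ρ.length, x < y →
      ρ.drop (x + 1) = arc ρ x y ++ ρ[y] :: ρ.drop (y + 1) := by
    intro x y hxy
    have hxy' : (x : ℕ) < y := hxy
    rw [arc, if_pos hxy']
    conv_lhs => rw [← List.take_append_drop (y - (x + 1)) (ρ.drop (x + 1))]
    rw [List.drop_drop, show (x : ℕ) + 1 + (y - (x + 1)) = y by omega]
    simp
  rcases lt_or_gt_of_ne h with hxy | hxy
  · have hn : ¬ (y : ℕ) < x := not_lt.2 (le_of_lt hxy)
    rw [coe_eq_arc ρ x]
    have : arc ρ x x = arc ρ x y ++ ρ[y] :: arc ρ y x := by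
      conv_lhs => rw [arc, if_neg (lt_irrefl _), aux x y hxy]
      rw [arc.eq_1 ρ y x, if_neg hn, List.append_assoc, List.cons_append]
    rw [this]
  · have hn : ¬ (x : ℕ) < y := not_lt.2 (le_of_lt hxy)
    rw [coe_eq_arc ρ y]
    have : arc ρ y y = arc ρ y x ++ ρ[x] :: arc ρ x y := by
      conv_lhs => rw [arc, if_neg (lt_irrefl _), aux y x hxy]
      rw [arc.eq_1 ρ x y, if_neg hn, List.append_assoc, List.cons_append]
    rw [this, Cycle.coe_eq_coe]
    simpa using List.isRotated_append (l := ρ[y] :: arc ρ y x) (l' := ρ[x] :: arc ρ x y)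

theorem isPathFromTo_arc {d : ℕ} {ρ : List (Edge d)} (hρ : IsClosed (ρ : Cycle (Edge d)))
    (x : Fin ρ.length) : IsPathFromTo ρ[x].tgt ρ[x].src (arc ρ x x) := by
  rw [coe_eq_arc ρ x] at hρ
  exact isClosed_cons.1 hρ

theorem isPathFromTo_arc_arc {d : ℕ} {ρ : List (Edge d)} (hρ : IsClosed (ρ : Cycle (Edge d)))
    {x y : Fin ρ.length} (h : x ≠ y) :
    IsPathFromTo ρ[x].tgt ρ[y].src (arc ρ x y) ∧ IsPathFromTo ρ[y].tgt ρ[x].src (arc ρ y x) := by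
  rw [coe_eq_arc_arc ρ x y h] at hρ
  obtain ⟨w, h₁, h₂⟩ := isPathFromTo_append.1 (isClosed_cons.1 hρ)
  obtain ⟨rfl, h₂⟩ := h₂
  exact ⟨h₁, h₂⟩

theorem Loop.isClosed_path {d : ℕ} (l : Loop d) : IsClosed (l.path : Cycle (Edge d)) := by
  rw [l.coe_path]; exact l.2.1

/-- Locations `x ≠ y` of a closed path with the same edge. -/
def SameAt {d : ℕ} (ρ : List (Edge d)) (x y : Fin ρ.length) : Prop := x ≠ y ∧ ρ[y] = ρ[x]

/-- Locations `x ≠ y` of a closed path with mutually inverse edges. -/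
def InvAt {d : ℕ} (ρ : List (Edge d)) (x y : Fin ρ.length) : Prop := x ≠ y ∧ ρ[y] = ρ[x]⁻¹

/-- First component `[a e c]` of the positive splitting of `a e b e c`. -/
noncomputable def Loop.posSplit₁ {d : ℕ} (l : Loop d) (x y : Fin l.path.length)
    (h : SameAt l.path x y) : Loop d :=
  coreLoop (l.path[x] :: arc l.path y x) <| by
    have h₁ := (isPathFromTo_arc_arc l.isClosed_path h.1).2
    rw [h.2] at h₁
    exact isClosed_cons.2 h₁

/-- Second component `[b e]` of the positive splitting of `a e b e c`. -/
noncomputable def Loop.posSplit₂ {d : ℕ} (l : Loop d) (x y : Fin l.path.length)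
    (h : SameAt l.path x y) : Loop d :=
  coreLoop (arc l.path x y ++ [l.path[x]]) <| by
    have h₁ := (isPathFromTo_arc_arc l.isClosed_path h.1).1
    rw [h.2] at h₁
    exact IsPathFromTo.isClosed (h₁.append ⟨rfl, rfl⟩)

/-- First component `[a c]` of the negative splitting of `a e b e⁻¹ c`. -/
noncomputable def Loop.negSplit₁ {d : ℕ} (l : Loop d) (x y : Fin l.path.length)
    (h : InvAt l.path x y) : Loop d :=
  coreLoop (arc l.path y x) <| by
    have h₁ := (isPathFromTo_arc_arc l.isClosed_path h.1).2
    rw [h.2] at h₁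
    exact IsPathFromTo.isClosed h₁

/-- Second component `[b]` of the negative splitting of `a e b e⁻¹ c`. -/
noncomputable def Loop.negSplit₂ {d : ℕ} (l : Loop d) (x y : Fin l.path.length)
    (h : InvAt l.path x y) : Loop d :=
  coreLoop (arc l.path x y) <| by
    have h₁ := (isPathFromTo_arc_arc l.isClosed_path h.1).1
    rw [h.2] at h₁
    exact IsPathFromTo.isClosed h₁

/-- Negative twisting `[a b⁻¹ c]` of `a e b e c`. -/
noncomputable def Loop.negTwist {d : ℕ} (l : Loop d) (x y : Fin l.path.length)
    (h : SameAt l.path x y) : Loop d :=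
  coreLoop (pathInv (arc l.path x y) ++ arc l.path y x) <| by
    obtain ⟨h₁, h₂⟩ := isPathFromTo_arc_arc l.isClosed_path h.1
    rw [h.2] at h₁ h₂
    exact IsPathFromTo.isClosed (h₁.inv.append h₂)

/-- Positive twisting `[a e b⁻¹ e⁻¹ c]` of `a e b e⁻¹ c`. -/
noncomputable def Loop.posTwist {d : ℕ} (l : Loop d) (x y : Fin l.path.length)
    (h : InvAt l.path x y) : Loop d :=
  coreLoop (l.path[x] :: (pathInv (arc l.path x y) ++ l.path[x]⁻¹ :: arc l.path y x)) <| by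
    obtain ⟨h₁, h₂⟩ := isPathFromTo_arc_arc l.isClosed_path h.1
    rw [h.2] at h₁ h₂
    exact isClosed_cons.2 (h₁.inv.append ⟨rfl, h₂⟩)

/-- The edge of `ρ'` at location `y` is the edge of `ρ` at location `x`, or its inverse. -/
def Parallel {d : ℕ} (ρ ρ' : List (Edge d)) (x : Fin ρ.length) (y : Fin ρ'.length) : Prop :=
  ρ'[y] = ρ[x] ∨ ρ'[y] = ρ[x]⁻¹

open scoped Classical in
/-- Positive merger of the closed paths `ρ` and `ρ'` at locations `x` and `y`:
`[a e d c e b]` for `ρ = a e b`, `ρ' = c e d`, and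
`[a e c⁻¹ d⁻¹ e b]` for `ρ = a e b`, `ρ' = c e⁻¹ d`. -/
noncomputable def posMerge {d : ℕ} (ρ ρ' : List (Edge d)) (hρ : IsClosed (ρ : Cycle (Edge d)))
    (hρ' : IsClosed (ρ' : Cycle (Edge d))) (x : Fin ρ.length) (y : Fin ρ'.length)
    (h : Parallel ρ ρ' x y) : Loop d :=
  coreLoop (ρ[x] :: ((if ρ'[y] = ρ[x] then arc ρ' y y else pathInv (arc ρ' y y)) ++
    ρ[x] :: arc ρ x x)) <| by
    have h₁ := isPathFromTo_arc hρ x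
    have h₂ := isPathFromTo_arc hρ' y
    refine isClosed_cons.2 (IsPathFromTo.append (w := ρ[x].src) ?_ ⟨rfl, h₁⟩)
    split_ifs with he
    · rwa [he] at h₂
    · rw [h.resolve_left he] at h₂
      exact h₂.inv

open scoped Classical in
/-- Negative merger of the closed paths `ρ` and `ρ'` at locations `x` and `y`:
`[a c⁻¹ d⁻¹ b]` for `ρ = a e b`, `ρ' = c e d`, and
`[a d c b]` for `ρ = a e b`, `ρ' = c e⁻¹ d`. -/
noncomputable def negMerge {d : ℕ} (ρ ρ' : List (Edge d)) (hρ : IsClosed (ρ : Cycle (Edge d)))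
    (hρ' : IsClosed (ρ' : Cycle (Edge d))) (x : Fin ρ.length) (y : Fin ρ'.length)
    (h : Parallel ρ ρ' x y) : Loop d :=
  coreLoop ((if ρ'[y] = ρ[x] then pathInv (arc ρ' y y) else arc ρ' y y) ++ arc ρ x x) <| by
    have h₁ := isPathFromTo_arc hρ x
    have h₂ := isPathFromTo_arc hρ' y
    refine IsPathFromTo.isClosed (IsPathFromTo.append (w := ρ[x].tgt) ?_ h₁)
    split_ifs with he
    · rw [he] at h₂
      exact h₂.inv
    · rw [h.resolve_left he] at h₂
      exact h₂

/-! ### Plaquettes -/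

/-- A plaquette: a nonbacktracking closed path of length four. -/
def IsPlaquette {d : ℕ} (p : List (Edge d)) : Prop :=
  p.length = 4 ∧ IsClosed (p : Cycle (Edge d)) ∧ IsNonbacktracking (p : Cycle (Edge d))

/-- A positively oriented plaquette `e₁e₂e₃e₄`: `u(e₁)` is lexicographically the smallest of the
four vertices `u(e₁), u(e₂), u(e₃), u(e₄)`, and `v(e₁) = u(e₂)` is the second smallest. -/
def IsPosPlaquette {d : ℕ} (p : List (Edge d)) : Prop :=
  IsPlaquette p ∧ ∃ e₁ e₂ e₃ e₄ : Edge d, p = [e₁, e₂, e₃, e₄] ∧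
    toLex e₁.src < toLex e₂.src ∧ toLex e₂.src < toLex e₃.src ∧ toLex e₂.src < toLex e₄.src

theorem finite_edgesIn {d : ℕ} (Λ : Finset (Fin d → ℤ)) :
    {e : Edge d | e.src ∈ Λ ∧ e.tgt ∈ Λ}.Finite := by
  refine Set.Finite.of_finite_image (f := fun e : Edge d => (e.src, e.tgt))
    ((Λ ×ˢ Λ).finite_toSet.subset ?_) ?_
  · rintro _ ⟨e, he, rfl⟩
    simpa using he
  · intro e _ f _ h
    simp only [Prod.mk.injEq] at h
    exact Edge.ext h.1 h.2

theorem finite_posPlaquettesIn {d : ℕ} (Λ : Finset (Fin d → ℤ)) :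
    {p : List (Edge d) | IsPosPlaquette p ∧ ∀ e ∈ p, e.src ∈ Λ ∧ e.tgt ∈ Λ}.Finite := by
  have := (finite_edgesIn Λ).to_subtype
  refine ((List.finite_length_eq {e : Edge d | e.src ∈ Λ ∧ e.tgt ∈ Λ} 4).image
    (List.map Subtype.val)).subset ?_
  rintro p ⟨hp, h⟩
  refine ⟨p.attach.map fun e => ⟨e.1, h e.1 e.2⟩, ?_, ?_⟩
  · rw [Set.mem_ofPred_eq, List.length_map, List.length_attach, hp.1.1]
  · simp [List.map_map, Function.comp_def]

/-- The set `𝒫⁺_Λ` of positively oriented plaquettes with all vertices in `Λ`. -/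
noncomputable def posPlaquettesIn {d : ℕ} (Λ : Finset (Fin d → ℤ)) : Finset (List (Edge d)) :=
  (finite_posPlaquettesIn Λ).toFinset

theorem finite_posPlaquettesAt {d : ℕ} (e : Edge d) :
    {p : List (Edge d) | IsPosPlaquette p ∧ (e ∈ p ∨ e⁻¹ ∈ p)}.Finite := by
  have bd : ∀ (f : Edge d) (i : Fin d), |f.tgt i - f.src i| ≤ 1 := fun f i =>
    (Finset.single_le_sum (f := fun i => |f.tgt i - f.src i|) (fun _ _ => abs_nonneg _)
      (Finset.mem_univ i)).trans f.adj.le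
  refine (finite_posPlaquettesIn (Finset.Icc (fun i => e.src i - 4) (fun i => e.src i + 4))).subset
    fun p ⟨hp, he⟩ => ⟨hp, ?_⟩
  obtain ⟨⟨-, hc, -⟩, e₁, e₂, e₃, e₄, rfl, -⟩ := hp
  obtain ⟨h₁, h₂, h₃, h₄⟩ := isClosed_cons.1 hc
  have hs : ∃ f ∈ [e₁, e₂, e₃, e₄], e.src = f.src ∨ e.src = f.tgt := by
    rcases he with he | he
    · exact ⟨e, he, Or.inl rfl⟩
    · exact ⟨_, he, Or.inr rfl⟩
  obtain ⟨f, hf, hs⟩ := hs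
  intro g hg
  simp only [Finset.mem_Icc, Pi.le_def, ← forall_and]
  intro i
  have b₁ := abs_le.1 (bd e₁ i)
  have b₂ := abs_le.1 (bd e₂ i)
  have b₃ := abs_le.1 (bd e₃ i)
  have b₄ := abs_le.1 (bd e₄ i)
  have c₁ := congrFun h₁ i
  have c₂ := congrFun h₂ i
  have c₃ := congrFun h₃ i
  have c₄ := congrFun h₄ i
  have hs' : e.src i = f.src i ∨ e.src i = f.tgt i := hs.imp (congrFun · i) (congrFun · i)
  simp only [List.mem_cons, List.not_mem_nil, or_false] at hf hg
  rcases hf with rfl | rfl | rfl | rfl <;> rcases hg with rfl | rfl | rfl | rfl <;> omega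

/-- The set `𝒫⁺(e)` of positively oriented plaquettes that contain `e` or `e⁻¹`. -/
noncomputable def posPlaquettesAt {d : ℕ} (e : Edge d) : Finset (List (Edge d)) :=
  (finite_posPlaquettesAt e).toFinset

theorem isClosed_of_mem_posPlaquettesAt {d : ℕ} {e : Edge d} {p : List (Edge d)}
    (h : p ∈ posPlaquettesAt e) : IsClosed (p : Cycle (Edge d)) :=
  ((finite_posPlaquettesAt e).mem_toFinset.1 h).1.1.2.1

/-! ### Operations on loop sequences

The collections `𝕋^±(s)`, `𝕊^±(s)`, `𝕄^±(s)`, `𝔻^±(s)` are multisets: every operation, that is,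
every admissible choice of component loops, ordered pair of locations and plaquette, counts once. -/

/-- Replace the component `l_k` of the minimal representation by the sequence `L`. -/
noncomputable def LoopSeq.replace {d : ℕ} (s : LoopSeq d) (k : Fin s.minRep.length)
    (L : List (Loop d)) : LoopSeq d :=
  LoopSeq.mk (s.minRep.take k ++ L ++ s.minRep.drop (k + 1))

/-- Replace the component `l_k` of the minimal representation by `l` and remove `l_r`. -/
noncomputable def LoopSeq.replaceRemove {d : ℕ} (s : LoopSeq d) (k r : Fin s.minRep.length)
    (l : Loop d) : LoopSeq d :=
  LoopSeq.mk ((s.minRep.set k l).eraseIdx r)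

open scoped Classical in
/-- `𝕋⁺(s)` -/
noncomputable def LoopSeq.posTwistings {d : ℕ} (s : LoopSeq d) : Multiset (LoopSeq d) :=
  ∑ k : Fin s.minRep.length, ∑ x, ∑ y,
    if h : InvAt s.minRep[k].path x y then {s.replace k [s.minRep[k].posTwist x y h]} else 0

open scoped Classical in
/-- `𝕋⁻(s)` -/
noncomputable def LoopSeq.negTwistings {d : ℕ} (s : LoopSeq d) : Multiset (LoopSeq d) :=
  ∑ k : Fin s.minRep.length, ∑ x, ∑ y,
    if h : SameAt s.minRep[k].path x y then {s.replace k [s.minRep[k].negTwist x y h]} else 0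

open scoped Classical in
/-- `𝕊⁺(s)` -/
noncomputable def LoopSeq.posSplittings {d : ℕ} (s : LoopSeq d) : Multiset (LoopSeq d) :=
  ∑ k : Fin s.minRep.length, ∑ x, ∑ y,
    if h : SameAt s.minRep[k].path x y then
      {s.replace k [s.minRep[k].posSplit₁ x y h, s.minRep[k].posSplit₂ x y h]} else 0

open scoped Classical in
/-- `𝕊⁻(s)` -/
noncomputable def LoopSeq.negSplittings {d : ℕ} (s : LoopSeq d) : Multiset (LoopSeq d) :=
  ∑ k : Fin s.minRep.length, ∑ x, ∑ y,
    if h : InvAt s.minRep[k].path x y then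
      {s.replace k [s.minRep[k].negSplit₁ x y h, s.minRep[k].negSplit₂ x y h]} else 0

open scoped Classical in
/-- `𝕄⁺(s)` -/
noncomputable def LoopSeq.posMergers {d : ℕ} (s : LoopSeq d) : Multiset (LoopSeq d) :=
  ∑ k : Fin s.minRep.length, ∑ r : Fin s.minRep.length, ∑ x, ∑ y,
    if h : k ≠ r ∧ Parallel s.minRep[k].path s.minRep[r].path x y then
      {s.replaceRemove k r (posMerge s.minRep[k].path s.minRep[r].path
        s.minRep[k].isClosed_path s.minRep[r].isClosed_path x y h.2)} else 0

open scoped Classical in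
/-- `𝕄⁻(s)` -/
noncomputable def LoopSeq.negMergers {d : ℕ} (s : LoopSeq d) : Multiset (LoopSeq d) :=
  ∑ k : Fin s.minRep.length, ∑ r : Fin s.minRep.length, ∑ x, ∑ y,
    if h : k ≠ r ∧ Parallel s.minRep[k].path s.minRep[r].path x y then
      {s.replaceRemove k r (negMerge s.minRep[k].path s.minRep[r].path
        s.minRep[k].isClosed_path s.minRep[r].isClosed_path x y h.2)} else 0

open scoped Classical in
/-- `𝔻⁺(s)`: mergers of a component loop, at a location `x` with edge `e`, with a plaquette
`p ∈ 𝒫⁺(e)` at the location `y` of `e` or `e⁻¹` in `p` (there is exactly one such `y`). -/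
noncomputable def LoopSeq.posDeformations {d : ℕ} (s : LoopSeq d) : Multiset (LoopSeq d) :=
  ∑ k : Fin s.minRep.length, ∑ x : Fin s.minRep[k].path.length,
    ∑ p ∈ (posPlaquettesAt s.minRep[k].path[x]).attach, ∑ y,
      if h : Parallel s.minRep[k].path p.1 x y then
        {s.replace k [posMerge s.minRep[k].path p.1 s.minRep[k].isClosed_path
          (isClosed_of_mem_posPlaquettesAt p.2) x y h]} else 0

open scoped Classical in
/-- `𝔻⁻(s)` -/
noncomputable def LoopSeq.negDeformations {d : ℕ} (s : LoopSeq d) : Multiset (LoopSeq d) :=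
  ∑ k : Fin s.minRep.length, ∑ x : Fin s.minRep[k].path.length,
    ∑ p ∈ (posPlaquettesAt s.minRep[k].path[x]).attach, ∑ y,
      if h : Parallel s.minRep[k].path p.1 x y then
        {s.replace k [negMerge s.minRep[k].path p.1 s.minRep[k].isClosed_path
          (isClosed_of_mem_posPlaquettesAt p.2) x y h]} else 0

/-! ### The group `SO(N)` and lattice gauge theory -/

/-- The group of `N × N` real orthogonal matrices of determinant one. -/
abbrev SO (N : ℕ) : Type := Matrix.specialOrthogonalGroup (Fin N) ℝ

instance (N : ℕ) : IsTopologicalGroup (SO N) where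
  continuous_mul := by fun_prop
  continuous_inv := by
    refine Continuous.subtype_mk (f := fun A : SO N => star (A : Matrix (Fin N) (Fin N) ℝ)) ?_ _
    exact continuous_subtype_val.star

instance (N : ℕ) : MeasurableSpace (SO N) := borel _

instance (N : ℕ) : BorelSpace (SO N) := ⟨rfl⟩

instance (N : ℕ) : CompactSpace (SO N) := by
  suffices h : IsCompact ((Matrix.specialOrthogonalGroup (Fin N) ℝ :
      Submonoid (Matrix (Fin N) (Fin N) ℝ)) : Set (Matrix (Fin N) (Fin N) ℝ)) from
    isCompact_iff_compactSpace.1 h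
  refine IsCompact.of_isClosed_subset (s := Set.univ.pi fun _ => Set.univ.pi fun _ => Set.Icc (-1) 1)
    (isCompact_univ_pi fun _ => isCompact_univ_pi fun _ => isCompact_Icc) ?_ ?_
  · have : ((Matrix.specialOrthogonalGroup (Fin N) ℝ : Submonoid (Matrix (Fin N) (Fin N) ℝ)) :
        Set (Matrix (Fin N) (Fin N) ℝ)) = {A | A * star A = 1} ∩ {A | A.det = 1} := by
      ext A
      simp only [SetLike.mem_coe, Matrix.mem_specialOrthogonalGroup_iff,
        Matrix.mem_orthogonalGroup_iff, Set.mem_inter_iff, Set.mem_ofPred_eq,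
        Matrix.star_eq_conjTranspose, Matrix.conjTranspose_eq_transpose_of_trivial]
    rw [this]
    exact (isClosed_eq (continuous_id.mul continuous_id.star) continuous_const).inter
      (isClosed_eq continuous_id.matrix_det continuous_const)
  · intro A hA i _ j _
    have := entry_norm_bound_of_unitary (Matrix.mem_specialOrthogonalGroup_iff.1 hA).1 i j
    exact abs_le.1 this

/-- The Haar measure of `SO(N)`, with total mass one. -/
noncomputable def haarSO (N : ℕ) : Measure (SO N) := Measure.haarMeasure ⊤

/-- The set `E⁺_Λ` of positively oriented edges with both end points in `Λ`. -/
abbrev PosEdge {d : ℕ} (Λ : Finset (Fin d → ℤ)) : Type :=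
  {e : Edge d // e.IsPos ∧ e.src ∈ Λ ∧ e.tgt ∈ Λ}

noncomputable instance {d : ℕ} (Λ : Finset (Fin d → ℤ)) : Fintype (PosEdge Λ) :=
  ((finite_edgesIn Λ).subset fun _ h => h.2).fintype

/-- Configurations `(Q_e)_{e ∈ E⁺_Λ}` of `SO(N)` matrices. -/
abbrev Config {d : ℕ} (Λ : Finset (Fin d → ℤ)) (N : ℕ) : Type := PosEdge Λ → SO N

open scoped Classical in
/-- The matrix `Q_e` for `e ∈ E_Λ`, with `Q_{e⁻¹} = Q_e⁻¹` for `e ∈ E⁺_Λ`.  (The value `1` for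
edges that are not in `E_Λ` is a convention that is never used.) -/
noncomputable def Config.at {d : ℕ} {Λ : Finset (Fin d → ℤ)} {N : ℕ} (Q : Config Λ N)
    (e : Edge d) : SO N :=
  if h : e.IsPos ∧ e.src ∈ Λ ∧ e.tgt ∈ Λ then Q ⟨e, h⟩
  else if h : e⁻¹.IsPos ∧ e⁻¹.src ∈ Λ ∧ e⁻¹.tgt ∈ Λ then (Q ⟨e⁻¹, h⟩)⁻¹
  else 1

/-- `Tr(Q_{e_1} ⋯ Q_{e_n})` for a list `e_1 ⋯ e_n` of edges. -/
noncomputable def pathTrace {d : ℕ} {Λ : Finset (Fin d → ℤ)} {N : ℕ} (Q : Config Λ N)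
    (ρ : List (Edge d)) : ℝ :=
  Matrix.trace ((ρ.map Q.at).prod : SO N).1

theorem pathTrace_congr {d : ℕ} {Λ : Finset (Fin d → ℤ)} {N : ℕ} (Q : Config Λ N)
    (ρ ρ' : List (Edge d)) (h : ρ ~r ρ') : pathTrace Q ρ = pathTrace Q ρ' := by
  obtain ⟨n, hn, rfl⟩ := List.isRotated_iff_mod.1 h
  rw [List.rotate_eq_drop_append_take hn]
  conv_lhs => rw [← List.take_append_drop n ρ]
  simp only [pathTrace, List.map_append, List.prod_append, Submonoid.coe_mul]
  exact Matrix.trace_mul_comm _ _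

/-- The Wilson loop variable `W_l`. -/
noncomputable def wilson {d : ℕ} {Λ : Finset (Fin d → ℤ)} {N : ℕ} (Q : Config Λ N)
    (l : Loop d) : ℝ :=
  Quotient.lift (s := List.IsRotated.setoid _) (pathTrace Q)
    (fun ρ ρ' h => pathTrace_congr Q ρ ρ' h) l.1

/-- The unnormalized density `exp(N β ∑_{p ∈ 𝒫⁺_Λ} Tr(Q_p))`. -/
noncomputable def gaugeWeight {d : ℕ} (Λ : Finset (Fin d → ℤ)) (N : ℕ) (β : ℝ)
    (Q : Config Λ N) : ℝ :=
  Real.exp (N * β * ∑ p ∈ posPlaquettesIn Λ, pathTrace Q p)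

/-- The normalizing constant `Z_{Λ,N,β}`. -/
noncomputable def partitionFunction {d : ℕ} (Λ : Finset (Fin d → ℤ)) (N : ℕ) (β : ℝ) : ℝ :=
  ∫ Q : Config Λ N, gaugeWeight Λ N β Q ∂(Measure.pi fun _ => haarSO N)

/-- The probability measure `μ_{Λ,N,β}` of `SO(N)` lattice gauge theory on `Λ`. -/
noncomputable def gaugeMeasure {d : ℕ} (Λ : Finset (Fin d → ℤ)) (N : ℕ) (β : ℝ) :
    Measure (Config Λ N) :=
  (Measure.pi fun _ => haarSO N).withDensity fun Q =>
    ENNReal.ofReal ((partitionFunction Λ N β)⁻¹ * gaugeWeight Λ N β Q)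

/-- `φ(s) = ⟨W_{l_1} ⋯ W_{l_n}⟩ / N^n`, where `(l_1, …, l_n)` is the minimal representation
of `s`. -/
noncomputable def phi {d : ℕ} (Λ : Finset (Fin d → ℤ)) (N : ℕ) (β : ℝ) (s : LoopSeq d) : ℝ :=
  (∫ Q, (s.minRep.map (wilson Q)).prod ∂(gaugeMeasure Λ N β)) / (N : ℝ) ^ s.minRep.length

end LatticeGauge

namespace LatticeGauge

/-!
Left translation of a matrix `Q_e` by the rotations `exp (t X)`, `X = E_ab - E_ba`, preserves the
Haar measure, so the Lie derivative of every smooth function has integral zero. Apply this to the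
product of the weight `exp (N β ∑ Tr Q_p)` and the first derivative of
`f = W_{l_1} ⋯ W_{l_n} / N ^ n`, and sum over all edges `e` and all pairs `(a, b)`: the expectation
of the second derivatives of `f`, plus the first derivatives of `f` times those of the action,
vanishes. The identities `∑ X * M * X = 2 (Mᵀ - tr M)` and `∑ tr (X * A) X = 2 (Aᵀ - A)` evaluate
these sums. Two derivatives of the same factor at one location give `-(N - 1) |s| f`, at two
locations twistings (from `Mᵀ`) and splittings (from `tr M`); derivatives of two factors give
mergers, and derivatives of a factor and of the action give deformations, which are mergers with
plaquettes.
-/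

/-! ### Lie derivatives along one-parameter subgroups -/

section LieDeriv

variable {G : Type*} [TopologicalSpace G] [Group G] {γ : Multiplicative ℝ →* G}

/-- `f` and `f'` are continuous, and `f'` is the derivative of `f` along the orbits of the left
translations by the one-parameter subgroup `γ`. -/
structure HasLieDeriv (γ : Multiplicative ℝ →* G) (f f' : G → ℝ) : Prop where
  continuous : Continuous f
  continuous_deriv : Continuous f'
  hasDerivAt : ∀ g, HasDerivAt (fun t => f (γ (.ofAdd t) * g)) (f' g) 0

namespace HasLieDeriv

variable {f f' f₁ f₁' f₂ f₂' : G → ℝ}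

theorem hasDerivAt_orbit (h : HasLieDeriv γ f f') (g : G) (t : ℝ) :
    HasDerivAt (fun u => f (γ (.ofAdd u) * g)) (f' (γ (.ofAdd t) * g)) t := by
  have h₀ := h.hasDerivAt (γ (.ofAdd t) * g)
  rw [← sub_self t] at h₀
  refine (h₀.comp_sub_const t t).congr_of_eventuallyEq (.of_forall fun u => ?_)
  simp only [← mul_assoc, ← map_mul, ← ofAdd_add, sub_add_cancel]

/-- Differentiate the constant function `t ↦ ∫ f (γ t * g) dμ(g)` under the integral sign. -/
theorem integral_eq_zero [CompactSpace G] [ContinuousMul G] [MeasurableSpace G] [BorelSpace G]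
    {μ : Measure G} [IsFiniteMeasure μ] [μ.IsMulLeftInvariant] (h : HasLieDeriv γ f f') :
    ∫ g, f' g ∂μ = 0 := by
  obtain ⟨C, hC⟩ := isCompact_univ.exists_bound_of_continuousOn h.continuous_deriv.continuousOn
  have continuous_translate {k : G → ℝ} (hk : Continuous k) (t : ℝ) :
      Continuous fun g => k (γ (.ofAdd t) * g) := hk.comp (continuous_const_mul _)
  have hasDerivAt_integral := (hasDerivAt_integral_of_dominated_loc_of_deriv_le (μ := μ)
    (F := fun t g => f (γ (.ofAdd t) * g)) (F' := fun t g => f' (γ (.ofAdd t) * g))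
    (x₀ := 0) (bound := fun _ => C) Filter.univ_mem
    (.of_forall fun t => (continuous_translate h.continuous t).aestronglyMeasurable)
    ((continuous_translate h.continuous 0).integrable_of_hasCompactSupport
      (.of_compactSpace _))
    (continuous_translate h.continuous_deriv 0).aestronglyMeasurable
    (.of_forall fun _ _ _ => hC _ trivial) (integrable_const C)
    (.of_forall fun g t _ => h.hasDerivAt_orbit g t)).2
  simp only [integral_mul_left_eq_self f, integral_mul_left_eq_self f'] at hasDerivAt_integral
  exact hasDerivAt_integral.unique (hasDerivAt_const _ _)

theorem congr_deriv (h : HasLieDeriv γ f f₁') (h' : ∀ g, f₁' g = f₂' g) : HasLieDeriv γ f f₂' :=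
  funext h' ▸ h

theorem const (c : ℝ) : HasLieDeriv γ (fun _ => c) (fun _ => 0) :=
  ⟨continuous_const, continuous_const, fun _ => hasDerivAt_const _ _⟩

theorem mul (h₁ : HasLieDeriv γ f₁ f₁') (h₂ : HasLieDeriv γ f₂ f₂') :
    HasLieDeriv γ (fun g => f₁ g * f₂ g) (fun g => f₁' g * f₂ g + f₁ g * f₂' g) :=
  ⟨h₁.continuous.mul h₂.continuous,
    (h₁.continuous_deriv.mul h₂.continuous).add (h₁.continuous.mul h₂.continuous_deriv),
    fun g => by simpa using (h₁.hasDerivAt g).fun_mul (h₂.hasDerivAt g)⟩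

theorem const_mul (c : ℝ) (h : HasLieDeriv γ f f') :
    HasLieDeriv γ (fun g => c * f g) (fun g => c * f' g) :=
  ((const c).mul h).congr_deriv fun _ => by rw [zero_mul, zero_add]

theorem div_const (h : HasLieDeriv γ f f') (c : ℝ) :
    HasLieDeriv γ (fun g => f g / c) (fun g => f' g / c) := by
  simpa only [div_eq_inv_mul] using h.const_mul c⁻¹

theorem sub (h₁ : HasLieDeriv γ f₁ f₁') (h₂ : HasLieDeriv γ f₂ f₂') :
    HasLieDeriv γ (fun g => f₁ g - f₂ g) (fun g => f₁' g - f₂' g) :=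
  ⟨h₁.continuous.sub h₂.continuous, h₁.continuous_deriv.sub h₂.continuous_deriv,
    fun g => (h₁.hasDerivAt g).fun_sub (h₂.hasDerivAt g)⟩

theorem exp (h : HasLieDeriv γ f f') :
    HasLieDeriv γ (fun g => Real.exp (f g)) (fun g => Real.exp (f g) * f' g) :=
  ⟨h.continuous.rexp, h.continuous.rexp.mul h.continuous_deriv,
    fun g => by simpa using (h.hasDerivAt g).exp⟩

variable {ι : Type*} {s : Finset ι} {F F' : ι → G → ℝ}

theorem sum (h : ∀ i ∈ s, HasLieDeriv γ (F i) (F' i)) :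
    HasLieDeriv γ (fun g => ∑ i ∈ s, F i g) (fun g => ∑ i ∈ s, F' i g) :=
  ⟨continuous_finsetSum _ fun i hi => (h i hi).continuous,
    continuous_finsetSum _ fun i hi => (h i hi).continuous_deriv,
    fun g => HasDerivAt.fun_sum fun i hi => (h i hi).hasDerivAt g⟩

theorem prod [DecidableEq ι] (h : ∀ i ∈ s, HasLieDeriv γ (F i) (F' i)) :
    HasLieDeriv γ (fun g => ∏ i ∈ s, F i g)
      (fun g => ∑ i ∈ s, F' i g * ∏ j ∈ s.erase i, F j g) :=
  ⟨continuous_finsetProd _ fun i hi => (h i hi).continuous,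
    continuous_finsetSum _ fun i hi => (h i hi).continuous_deriv.mul
      (continuous_finsetProd _ fun j hj => (h j (Finset.mem_of_mem_erase hj)).continuous),
    fun g => by
      simpa [mul_comm] using HasDerivAt.fun_finsetProd fun i hi => (h i hi).hasDerivAt g⟩

end HasLieDeriv

/-- Entrywise Lie derivative of a matrix valued function. -/
def HasMatrixLieDeriv {m n : Type*} (γ : Multiplicative ℝ →* G) (A A' : G → Matrix m n ℝ) : Prop :=
  ∀ i j, HasLieDeriv γ (fun g => A g i j) (fun g => A' g i j)

namespace HasMatrixLieDeriv

variable {l m n : Type*} {A A' : G → Matrix l m ℝ} {B B' : G → Matrix m n ℝ}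

theorem const (M : Matrix m n ℝ) : HasMatrixLieDeriv γ (fun _ => M) (fun _ => 0) :=
  fun i j => .const (M i j)

theorem sub {A₁ A₁' : G → Matrix l m ℝ} (hA : HasMatrixLieDeriv γ A A')
    (hA₁ : HasMatrixLieDeriv γ A₁ A₁') :
    HasMatrixLieDeriv γ (fun g => A g - A₁ g) (fun g => A' g - A₁' g) :=
  fun i j => (hA i j).sub (hA₁ i j)

theorem transpose (hA : HasMatrixLieDeriv γ A A') :
    HasMatrixLieDeriv γ (fun g => (A g).transpose) (fun g => (A' g).transpose) :=
  fun i j => hA j i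

theorem mul [Fintype m] (hA : HasMatrixLieDeriv γ A A') (hB : HasMatrixLieDeriv γ B B') :
    HasMatrixLieDeriv γ (fun g => A g * B g) (fun g => A' g * B g + A g * B' g) := fun i j => by
  simpa only [Matrix.mul_apply, Matrix.add_apply, ← Finset.sum_add_distrib] using
    HasLieDeriv.sum fun k _ => (hA i k).mul (hB k j)

theorem const_mul [Fintype m] (M : Matrix l m ℝ) (hB : HasMatrixLieDeriv γ B B') :
    HasMatrixLieDeriv γ (fun g => M * B g) (fun g => M * B' g) := by
  simpa only [Matrix.zero_mul, zero_add] using (const M).mul hB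

theorem mul_const [Fintype m] (hA : HasMatrixLieDeriv γ A A') (M : Matrix m n ℝ) :
    HasMatrixLieDeriv γ (fun g => A g * M) (fun g => A' g * M) := by
  simpa only [Matrix.mul_zero, add_zero] using hA.mul (const M)

theorem trace [Fintype n] {A A' : G → Matrix n n ℝ} (hA : HasMatrixLieDeriv γ A A') :
    HasLieDeriv γ (fun g => (A g).trace) (fun g => (A' g).trace) :=
  HasLieDeriv.sum fun k _ => hA k k

end HasMatrixLieDeriv

end LieDeriv

/-! ### Rotations -/

section Rotation

open scoped Matrix

variable {n : Type*} [Fintype n] [DecidableEq n] {X : Matrix n n ℝ}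

theorem coe_inv_specialOrthogonalGroup (A : Matrix.specialOrthogonalGroup n ℝ) :
    (A⁻¹ : Matrix.specialOrthogonalGroup n ℝ).1 = A.1ᵀ := by
  rw [← Matrix.conjTranspose_eq_transpose_of_trivial, ← Matrix.star_eq_conjTranspose]
  rfl

theorem exp_add_smul (X : Matrix n n ℝ) (s t : ℝ) :
    NormedSpace.exp ((s + t) • X) = NormedSpace.exp (s • X) * NormedSpace.exp (t • X) := by
  rw [add_smul, Matrix.exp_add_of_commute _ _ (((Commute.refl X).smul_left s).smul_right t)]

theorem exp_smul_mul_transpose (hX : Xᵀ = -X) (t : ℝ) :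
    NormedSpace.exp (t • X) * (NormedSpace.exp (t • X))ᵀ = 1 := by
  rw [← Matrix.exp_transpose, Matrix.transpose_smul, hX, smul_neg, ← neg_smul, ← exp_add_smul,
    add_neg_cancel, zero_smul, NormedSpace.exp_zero]

theorem det_exp_smul (hX : Xᵀ = -X) (t : ℝ) : (NormedSpace.exp (t • X)).det = 1 := by
  have hdet := congrArg Matrix.det (exp_smul_mul_transpose hX (t / 2))
  rwa [Matrix.det_mul, Matrix.det_transpose, Matrix.det_one, ← Matrix.det_mul, ← exp_add_smul,
    add_halves] at hdet

/-- The one-parameter subgroup `t ↦ exp (t X)` of rotations generated by a skew matrix `X`. -/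
noncomputable def rotation (X : Matrix n n ℝ) (hX : Xᵀ = -X) :
    Multiplicative ℝ →* Matrix.specialOrthogonalGroup n ℝ where
  toFun t := ⟨NormedSpace.exp (t.toAdd • X), Matrix.mem_specialOrthogonalGroup_iff.2
    ⟨(Matrix.mem_orthogonalGroup_iff _ _).2 (exp_smul_mul_transpose hX t.toAdd),
      det_exp_smul hX t.toAdd⟩⟩
  map_one' := Subtype.ext <| by simp
  map_mul' s t := Subtype.ext <| by simpa using exp_add_smul X s.toAdd t.toAdd

open scoped Matrix.Norms.Operator in
theorem hasDerivAt_rotation (hX : Xᵀ = -X) (i j : n) :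
    HasDerivAt (fun t => (rotation X hX (.ofAdd t)).1 i j) (X i j) 0 := by
  have hasDerivAt_exp := hasDerivAt_exp_smul_const X (0 : ℝ)
  rw [zero_smul, NormedSpace.exp_zero, one_mul] at hasDerivAt_exp
  exact hasDerivAt_pi.1 (hasDerivAt_pi.1 hasDerivAt_exp i) j

end Rotation

section SkewGen

open scoped Matrix

variable {n R : Type*} [DecidableEq n] [CommRing R]

/-- The generator `E_{ab} - E_{ba}` of the rotations in the `(a, b)` coordinate plane. -/
def skewGen (a b : n) : Matrix n n R := Matrix.single a b 1 - Matrix.single b a 1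

theorem transpose_skewGen (a b : n) : (skewGen a b : Matrix n n R)ᵀ = -skewGen a b := by
  simp only [skewGen, Matrix.transpose_sub, Matrix.transpose_single, neg_sub]

variable [Fintype n]

theorem sum_skewGen_mul_mul_skewGen (M : Matrix n n R) :
    ∑ a, ∑ b, skewGen a b * M * skewGen a b = (2 : R) • (Mᵀ - M.trace • 1) := by
  have expand (a b : n) : skewGen a b * M * skewGen a b =
      (Matrix.single a b (Mᵀ a b) + Matrix.single b a (Mᵀ b a)) -
        (Matrix.single a a (M b b) + Matrix.single b b (M a a)) := by
    simp only [skewGen, sub_mul, mul_sub, Matrix.single_mul_mul_single, one_mul, mul_one,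
      Matrix.transpose_apply]
    abel
  have sum_offDiag : ∑ a, ∑ b, Matrix.single a b (Mᵀ a b) = Mᵀ :=
    (Matrix.matrix_eq_sum_single _).symm
  have sum_diag : ∑ a, ∑ b, Matrix.single a a (M b b) = M.trace • (1 : Matrix n n R) := by
    simp only [← Matrix.sum_single_one, Finset.smul_sum, Matrix.smul_single, smul_eq_mul, mul_one,
      Matrix.trace, Matrix.diag_apply]
    exact Finset.sum_congr rfl fun a _ =>
      (map_sum (Matrix.singleAddMonoidHom (α := R) a a) _ _).symm
  simp only [expand, Finset.sum_sub_distrib, Finset.sum_add_distrib]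
  rw [Finset.sum_comm (f := fun a b => Matrix.single b a (Mᵀ b a)),
    Finset.sum_comm (f := fun a b => Matrix.single b b (M a a)), sum_offDiag, sum_diag]
  module

theorem trace_skewGen_mul (a b : n) (A : Matrix n n R) :
    (skewGen a b * A).trace = A b a - A a b := by
  simp only [skewGen, sub_mul, Matrix.trace_sub, Matrix.trace_single_mul, smul_eq_mul, one_mul]

theorem sum_trace_skewGen_mul_smul_skewGen (A : Matrix n n R) :
    ∑ a, ∑ b, (skewGen a b * A).trace • skewGen a b = (2 : R) • (Aᵀ - A) := by
  have sum_smul_single (B : Matrix n n R) :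
      ∑ a, ∑ b, B a b • Matrix.single a b (1 : R) = B := by
    simp only [Matrix.smul_single, smul_eq_mul, mul_one, ← Matrix.matrix_eq_sum_single]
  have sum_smul_skewGen (B : Matrix n n R) : ∑ a, ∑ b, B a b • skewGen a b = B - Bᵀ := by
    simp only [skewGen, smul_sub, Finset.sum_sub_distrib, sum_smul_single]
    rw [Finset.sum_comm (f := fun a b => B a b • Matrix.single b a 1)]
    exact congrArg (B - ·) (sum_smul_single Bᵀ)
  have expand (a b : n) : (skewGen a b * A).trace • skewGen a b =
      (Aᵀ - A) a b • (skewGen a b : Matrix n n R) := by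
    rw [trace_skewGen_mul, Matrix.sub_apply, Matrix.transpose_apply]
  simp only [expand, sum_smul_skewGen, Matrix.transpose_sub, Matrix.transpose_transpose]
  module

end SkewGen

open scoped Matrix

/-! ### Edges and holonomies -/

variable {d : ℕ} {Λ : Finset (Fin d → ℤ)} {N : ℕ}

theorem Edge.not_isPos_inv {e : Edge d} (h : e.IsPos) : ¬ e⁻¹.IsPos := lt_asymm h

theorem Edge.isPos_or_isPos_inv (e : Edge d) : e.IsPos ∨ e⁻¹.IsPos := by
  refine lt_or_gt_of_ne fun h => ?_
  have src_eq_tgt : e.src = e.tgt := toLex.injective h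
  simpa [src_eq_tgt] using e.adj

theorem Edge.inv_ne (e : Edge d) : e⁻¹ ≠ e := fun h => by
  rcases e.isPos_or_isPos_inv with he | he
  · exact e.not_isPos_inv he (h ▸ he)
  · exact e⁻¹.not_isPos_inv he (congrArg (·⁻¹) h ▸ he)

theorem Edge.inv_eq_iff {e f : Edge d} : e⁻¹ = f ↔ e = f⁻¹ :=
  ⟨fun h => h ▸ rfl, fun h => h ▸ rfl⟩

/-- Both end points of the edge lie in `Λ`, that is, the edge or its inverse belongs to `E⁺_Λ`. -/
def Edge.InLattice (Λ : Finset (Fin d → ℤ)) (e : Edge d) : Prop := e.src ∈ Λ ∧ e.tgt ∈ Λ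

theorem Edge.InLattice.exists_posEdge {f : Edge d} (hf : f.InLattice Λ) :
    ∃ e : PosEdge Λ, f = e.1 ∨ f = e.1⁻¹ := by
  rcases f.isPos_or_isPos_inv with h | h
  · exact ⟨⟨f, h, hf.1, hf.2⟩, .inl rfl⟩
  · exact ⟨⟨f⁻¹, h, hf.2, hf.1⟩, .inr rfl⟩

theorem Config.at_coe (Q : Config Λ N) (e : PosEdge Λ) : Q.at e.1 = Q e := by
  rw [Config.at, dif_pos e.2]

theorem Config.at_inv (Q : Config Λ N) (e : Edge d) : Q.at e⁻¹ = (Q.at e)⁻¹ := by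
  by_cases h : e.IsPos ∧ e.src ∈ Λ ∧ e.tgt ∈ Λ
  · rw [Config.at, dif_neg (fun h' => Edge.not_isPos_inv h.1 h'.1), Config.at, dif_pos h]
    exact dif_pos h
  · by_cases h' : e⁻¹.IsPos ∧ e⁻¹.src ∈ Λ ∧ e⁻¹.tgt ∈ Λ
    · rw [Config.at, dif_pos h', Config.at, dif_neg h, dif_pos h', inv_inv]
    · rw [Config.at, dif_neg h', Config.at, dif_neg h, dif_neg h', inv_one]
      exact dif_neg h

theorem Config.coe_at_inv (Q : Config Λ N) (e : Edge d) : (Q.at e⁻¹).1 = (Q.at e).1ᵀ := by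
  rw [Q.at_inv, coe_inv_specialOrthogonalGroup]

theorem Config.coe_at_mul_transpose (Q : Config Λ N) (e : Edge d) :
    (Q.at e).1 * (Q.at e).1ᵀ = 1 := by
  rw [← coe_inv_specialOrthogonalGroup, ← Submonoid.coe_mul, mul_inv_cancel, Submonoid.coe_one]

theorem Config.transpose_mul_coe_at (Q : Config Λ N) (e : Edge d) :
    (Q.at e).1ᵀ * (Q.at e).1 = 1 := by
  rw [← coe_inv_specialOrthogonalGroup, ← Submonoid.coe_mul, inv_mul_cancel, Submonoid.coe_one]

theorem Config.continuous_at (e : Edge d) : Continuous fun Q : Config Λ N => Q.at e := by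
  unfold Config.at
  split_ifs <;> fun_prop

/-- The ordered product of the matrices along a path. -/
noncomputable def holonomy (Q : Config Λ N) (ρ : List (Edge d)) : Matrix (Fin N) (Fin N) ℝ :=
  ((ρ.map Q.at).prod : SO N).1

theorem pathTrace_eq (Q : Config Λ N) (ρ : List (Edge d)) :
    pathTrace Q ρ = (holonomy Q ρ).trace := rfl

theorem holonomy_nil (Q : Config Λ N) : holonomy Q [] = 1 := rfl

theorem holonomy_append (Q : Config Λ N) (ρ ρ' : List (Edge d)) :
    holonomy Q (ρ ++ ρ') = holonomy Q ρ * holonomy Q ρ' := by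
  rw [holonomy, List.map_append, List.prod_append, Submonoid.coe_mul, holonomy, holonomy]

theorem holonomy_cons (Q : Config Λ N) (e : Edge d) (ρ : List (Edge d)) :
    holonomy Q (e :: ρ) = (Q.at e).1 * holonomy Q ρ := by
  rw [holonomy, List.map_cons, List.prod_cons, Submonoid.coe_mul, holonomy]

theorem holonomy_pathInv (Q : Config Λ N) (ρ : List (Edge d)) :
    holonomy Q (pathInv ρ) = (holonomy Q ρ)ᵀ := by
  rw [holonomy, holonomy, ← coe_inv_specialOrthogonalGroup, List.prod_inv_reverse, pathInv]
  simp only [List.map_reverse, List.map_map, Function.comp_def, Config.at_inv]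

/-! ### Derivatives of the matrices on edges -/

/-- A direction of differentiation on `Config Λ N`: an edge of `E⁺_Λ` and a coordinate plane. -/
abbrev Direction (Λ : Finset (Fin d → ℤ)) (N : ℕ) : Type := PosEdge Λ × Fin N × Fin N

variable (D : Direction Λ N)

open scoped Classical in
/-- The one-parameter subgroup rotating the matrix on the edge `D.1` in the plane `D.2`. -/
noncomputable def flow : Multiplicative ℝ →* Config Λ N :=
  (MonoidHom.mulSingle (fun _ => SO N) D.1).comp
    (rotation (skewGen D.2.1 D.2.2) (transpose_skewGen _ _))

theorem at_flow_mul (t : Multiplicative ℝ) (Q : Config Λ N) :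
    (flow D t * Q).at D.1.1 =
      rotation (skewGen D.2.1 D.2.2) (transpose_skewGen _ _) t * Q.at D.1.1 := by
  classical
  simp only [Config.at_coe, flow, Pi.mul_apply, MonoidHom.comp_apply, MonoidHom.mulSingle_apply,
    Pi.mulSingle_eq_same]

variable {D} in
theorem at_flow_mul_of_ne {f : Edge d} (hf : f ≠ D.1.1) (hf' : f⁻¹ ≠ D.1.1)
    (t : Multiplicative ℝ) (Q : Config Λ N) : (flow D t * Q).at f = Q.at f := by
  classical
  have apply_of_ne (g : PosEdge Λ) (hg : g.1 ≠ D.1.1) : (flow D t * Q) g = Q g := by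
    rw [Pi.mul_apply, flow, MonoidHom.comp_apply, MonoidHom.mulSingle_apply,
      Pi.mulSingle_eq_of_ne (fun h => hg (congrArg _ h)), one_mul]
  simp only [Config.at]
  split_ifs
  · exact apply_of_ne _ hf
  · rw [apply_of_ne _ hf']
  · rfl

open scoped Classical in
/-- The generator of `flow D` on the edge `f`. -/
noncomputable def edgeGen (f : Edge d) : Matrix (Fin N) (Fin N) ℝ :=
  if f = D.1.1 then skewGen D.2.1 D.2.2 else 0

theorem transpose_edgeGen (f : Edge d) : (edgeGen D f)ᵀ = -edgeGen D f := by
  rw [edgeGen]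
  split_ifs
  · exact transpose_skewGen _ _
  · rw [Matrix.transpose_zero, neg_zero]

theorem edgeGen_self : edgeGen D D.1.1 = skewGen D.2.1 D.2.2 := if_pos rfl

variable {D} in
theorem edgeGen_of_ne {f : Edge d} (h : f ≠ D.1.1) : edgeGen D f = 0 := if_neg h

theorem edgeGen_inv_self : edgeGen D D.1.1⁻¹ = 0 := edgeGen_of_ne D.1.1.inv_ne

/-- The derivative of `Q_f` in the direction `D`; the second term comes from
`Q_f = (Q_{f⁻¹})⁻¹`. -/
noncomputable def edgeDeriv (f : Edge d) (Q : Config Λ N) : Matrix (Fin N) (Fin N) ℝ :=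
  edgeGen D f * (Q.at f).1 - (Q.at f).1 * edgeGen D f⁻¹

/-- The second derivative of `Q_f` in the direction `D`. -/
noncomputable def edgeDerivTwo (f : Edge d) (Q : Config Λ N) : Matrix (Fin N) (Fin N) ℝ :=
  edgeGen D f * edgeDeriv D f Q - edgeDeriv D f Q * edgeGen D f⁻¹

theorem edgeDeriv_self (Q : Config Λ N) :
    edgeDeriv D D.1.1 Q = skewGen D.2.1 D.2.2 * (Q.at D.1.1).1 := by
  rw [edgeDeriv, edgeGen_self, edgeGen_inv_self, mul_zero, sub_zero]

variable {D} in
theorem edgeDeriv_of_ne {f : Edge d} (hf : f ≠ D.1.1) (hf' : f⁻¹ ≠ D.1.1) (Q : Config Λ N) :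
    edgeDeriv D f Q = 0 := by
  rw [edgeDeriv, edgeGen_of_ne hf, edgeGen_of_ne hf', zero_mul, mul_zero, sub_zero]

theorem edgeDeriv_inv (f : Edge d) (Q : Config Λ N) :
    edgeDeriv D f⁻¹ Q = (edgeDeriv D f Q)ᵀ := by
  simp only [edgeDeriv, Q.coe_at_inv, Edge.inv_inv, Matrix.transpose_sub, Matrix.transpose_mul,
    transpose_edgeGen, mul_neg, neg_mul, sub_neg_eq_add]
  abel

theorem trace_edgeDeriv_inv_mul (f : Edge d) (Q : Config Λ N) (A : Matrix (Fin N) (Fin N) ℝ) :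
    (edgeDeriv D f⁻¹ Q * A).trace = (edgeDeriv D f Q * Aᵀ).trace := by
  rw [edgeDeriv_inv, ← Matrix.trace_transpose, Matrix.transpose_mul, Matrix.transpose_transpose,
    Matrix.trace_mul_comm]

theorem edgeDeriv_eq_zero_or {f g : Edge d} (h : g ≠ f) (h' : g ≠ f⁻¹) (Q : Config Λ N) :
    edgeDeriv D f Q = 0 ∨ edgeDeriv D g Q = 0 := by
  by_cases hf : f = D.1.1
  · exact .inr (edgeDeriv_of_ne (hf ▸ h) (hf ▸ fun hg => h' (Edge.inv_eq_iff.1 hg)) Q)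
  by_cases hf' : f⁻¹ = D.1.1
  · exact .inr (edgeDeriv_of_ne (hf' ▸ h') (hf' ▸ fun hg => h (Edge.inv_eq_iff.1 hg)) Q)
  exact .inl (edgeDeriv_of_ne hf hf' Q)

theorem edgeDeriv_transpose (f : Edge d) (Q : Config Λ N) :
    (edgeDeriv D f Q)ᵀ = -((Q.at f).1ᵀ * edgeDeriv D f Q * (Q.at f).1ᵀ) := by
  simp only [edgeDeriv, Matrix.transpose_sub, Matrix.transpose_mul, transpose_edgeGen, mul_sub,
    sub_mul, mul_neg, neg_mul, mul_assoc, Q.coe_at_mul_transpose, mul_one]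
  rw [← mul_assoc (Q.at f).1ᵀ (Q.at f).1, Q.transpose_mul_coe_at, one_mul]
  abel

theorem edgeDerivTwo_eq (f : Edge d) (Q : Config Λ N) :
    edgeDerivTwo D f Q = edgeDeriv D f Q * (Q.at f).1ᵀ * edgeDeriv D f Q := by
  by_cases hf : f = D.1.1
  · subst hf
    rw [edgeDerivTwo, edgeDeriv_self, edgeGen_self, edgeGen_inv_self, mul_zero, sub_zero,
      mul_assoc _ _ (_)ᵀ, Q.coe_at_mul_transpose, mul_one]
  · have cancel (M : Matrix (Fin N) (Fin N) ℝ) : (Q.at f).1ᵀ * ((Q.at f).1 * M) = M := by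
      rw [← mul_assoc, Q.transpose_mul_coe_at, one_mul]
    simp only [edgeDerivTwo, edgeDeriv, edgeGen_of_ne hf, zero_mul, zero_sub, neg_mul, mul_neg,
      neg_neg, neg_zero, mul_assoc, cancel]

theorem hasMatrixLieDeriv_at_self : HasMatrixLieDeriv (flow D) (fun Q => (Q.at D.1.1).1)
    (fun Q => skewGen D.2.1 D.2.2 * (Q.at D.1.1).1) := fun i j => by
  have continuous_entry (k : Fin N) : Continuous fun Q : Config Λ N => (Q.at D.1.1).1 k j :=
    (continuous_subtype_val.comp (Config.continuous_at _)).matrix_elem k j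
  refine ⟨continuous_entry i, ?_, fun Q => ?_⟩
  · simp only [Matrix.mul_apply]
    exact continuous_finsetSum _ fun k _ => continuous_const.mul (continuous_entry k)
  · simp only [at_flow_mul, Submonoid.coe_mul, Matrix.mul_apply]
    exact HasDerivAt.fun_sum fun k _ =>
      (hasDerivAt_rotation (transpose_skewGen D.2.1 D.2.2) i k).mul_const _

theorem hasMatrixLieDeriv_at (f : Edge d) :
    HasMatrixLieDeriv (flow D) (fun Q => (Q.at f).1) (edgeDeriv D f) := by
  have deriv_self : HasMatrixLieDeriv (flow D) (fun Q => (Q.at D.1.1).1) (edgeDeriv D D.1.1) := by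
    simpa only [← edgeDeriv_self] using hasMatrixLieDeriv_at_self D
  by_cases hf : f = D.1.1
  · exact hf ▸ deriv_self
  by_cases hf' : f⁻¹ = D.1.1
  · rw [Edge.inv_eq_iff.1 hf']
    simpa only [Config.coe_at_inv, ← edgeDeriv_inv] using deriv_self.transpose
  · refine fun i j => ⟨(continuous_subtype_val.comp (Config.continuous_at f)).matrix_elem i j, ?_,
      fun Q => ?_⟩
    · simp only [edgeDeriv_of_ne hf hf', continuous_const]
    · simp only [at_flow_mul_of_ne hf hf', edgeDeriv_of_ne hf hf']
      exact hasDerivAt_const _ _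

theorem hasMatrixLieDeriv_edgeDeriv (f : Edge d) :
    HasMatrixLieDeriv (flow D) (edgeDeriv D f) (edgeDerivTwo D f) :=
  ((hasMatrixLieDeriv_at D f).const_mul _).sub ((hasMatrixLieDeriv_at D f).mul_const _)

theorem hasMatrixLieDeriv_holonomy (ρ : List (Edge d)) :
    HasMatrixLieDeriv (flow D) (fun Q => holonomy Q ρ) (fun Q => ∑ x : Fin ρ.length,
      holonomy Q (ρ.take x) * edgeDeriv D ρ[x] Q * holonomy Q (ρ.drop (x + 1))) := by
  induction ρ with
  | nil => simpa [holonomy_nil] using HasMatrixLieDeriv.const 1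
  | cons e ρ ih =>
    simpa [holonomy_cons, Fin.sum_univ_succ, Finset.mul_sum, mul_assoc, holonomy_nil] using
      (hasMatrixLieDeriv_at D e).mul ih

/-! ### Contraction of edge derivatives over all directions -/

section Contraction

variable (Q : Config Λ N) {f : Edge d} (hf : f.InLattice Λ) (A B : Matrix (Fin N) (Fin N) ℝ)

theorem sum_edgeDeriv_posEdge {M : Type*} [AddCommMonoid M] (e : PosEdge Λ)
    {F : Matrix (Fin N) (Fin N) ℝ → M} (hF : F 0 = 0) :
    ∑ D : Direction Λ N, F (edgeDeriv D e.1 Q) = ∑ a, ∑ b, F (skewGen a b * (Q.at e.1).1) := by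
  rw [Fintype.sum_prod_type, Finset.sum_eq_single_of_mem e (Finset.mem_univ e),
    Fintype.sum_prod_type]
  · simp only [← edgeDeriv_self (e, _, _)]
  · refine fun e' _ he => Finset.sum_eq_zero fun _ _ => ?_
    rw [edgeDeriv_of_ne, hF]
    · exact fun h => he (Subtype.ext h.symm)
    · exact fun h => e.1.not_isPos_inv e.2.1 (h ▸ e'.2.1)

include hf

theorem sum_edgeDeriv_mul_mul_edgeDeriv :
    ∑ D : Direction Λ N, edgeDeriv D f Q * A * edgeDeriv D f Q =
      (2 : ℝ) • (Aᵀ - (A * (Q.at f).1).trace • (Q.at f).1) := by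
  have posEdge (e : PosEdge Λ) (M : Matrix (Fin N) (Fin N) ℝ) :
      ∑ D : Direction Λ N, edgeDeriv D e.1 Q * M * edgeDeriv D e.1 Q =
        (2 : ℝ) • (Mᵀ - (M * (Q.at e.1).1).trace • (Q.at e.1).1) := by
    have contraction := congrArg (· * (Q.at e.1).1)
      (sum_skewGen_mul_mul_skewGen ((Q.at e.1).1 * M))
    simp only [Finset.sum_mul, Matrix.smul_mul, sub_mul, Matrix.transpose_mul, mul_assoc,
      Q.transpose_mul_coe_at, mul_one, one_mul] at contraction
    rw [sum_edgeDeriv_posEdge (F := fun d => d * M * d) Q e (mul_zero _), Matrix.trace_mul_comm M]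
    simpa only [mul_assoc] using contraction
  obtain ⟨e, rfl | rfl⟩ := hf.exists_posEdge
  · exact posEdge e A
  · rw [← Matrix.transpose_inj, Matrix.transpose_sum]
    simp only [Matrix.transpose_mul, edgeDeriv_inv, Matrix.transpose_transpose, ← mul_assoc,
      posEdge e Aᵀ, Q.coe_at_inv, Matrix.transpose_smul, Matrix.transpose_sub]
    rw [← Matrix.trace_transpose (A * _), Matrix.transpose_mul, Matrix.transpose_transpose,
      Matrix.trace_mul_comm Aᵀ]

theorem sum_edgeDeriv_mul_mul_transpose_edgeDeriv :
    ∑ D : Direction Λ N, edgeDeriv D f Q * A * (edgeDeriv D f Q)ᵀ =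
      (2 : ℝ) • (A.trace • 1 - (Q.at f).1 * Aᵀ * (Q.at f).1ᵀ) := by
  have expand (D : Direction Λ N) : edgeDeriv D f Q * A * (edgeDeriv D f Q)ᵀ =
      -(edgeDeriv D f Q * (A * (Q.at f).1ᵀ) * edgeDeriv D f Q * (Q.at f).1ᵀ) := by
    rw [edgeDeriv_transpose]
    simp only [mul_neg, mul_assoc]
  simp only [expand, Finset.sum_neg_distrib, ← Finset.sum_mul,
    sum_edgeDeriv_mul_mul_edgeDeriv Q hf, Matrix.transpose_mul, Matrix.transpose_transpose,
    mul_assoc A, Q.transpose_mul_coe_at, Q.coe_at_mul_transpose, mul_one, Matrix.smul_mul, sub_mul]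
  module

theorem sum_trace_edgeDeriv_mul_smul_edgeDeriv :
    ∑ D : Direction Λ N, (edgeDeriv D f Q * A).trace • edgeDeriv D f Q =
      (2 : ℝ) • (Aᵀ - (Q.at f).1 * A * (Q.at f).1) := by
  have posEdge (e : PosEdge Λ) (M : Matrix (Fin N) (Fin N) ℝ) :
      ∑ D : Direction Λ N, (edgeDeriv D e.1 Q * M).trace • edgeDeriv D e.1 Q =
        (2 : ℝ) • (Mᵀ - (Q.at e.1).1 * M * (Q.at e.1).1) := by
    have contraction := congrArg (· * (Q.at e.1).1)
      (sum_trace_skewGen_mul_smul_skewGen ((Q.at e.1).1 * M))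
    simp only [Finset.sum_mul, Matrix.smul_mul, sub_mul, Matrix.transpose_mul, mul_assoc,
      Q.transpose_mul_coe_at, mul_one] at contraction
    rw [sum_edgeDeriv_posEdge (F := fun d => (d * M).trace • d) Q e (smul_zero _)]
    simpa only [mul_assoc] using contraction
  obtain ⟨e, rfl | rfl⟩ := hf.exists_posEdge
  · exact posEdge e A
  · simp only [trace_edgeDeriv_inv_mul]
    simp only [edgeDeriv_inv, ← Matrix.transpose_smul, ← Matrix.transpose_sum, posEdge e Aᵀ]
    simp only [Q.coe_at_inv, Matrix.transpose_smul, Matrix.transpose_sub, Matrix.transpose_mul,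
      Matrix.transpose_transpose, mul_assoc]

theorem sum_edgeDerivTwo :
    ∑ D : Direction Λ N, edgeDerivTwo D f Q = (2 * (1 - N) : ℝ) • (Q.at f).1 := by
  simp only [edgeDerivTwo_eq, sum_edgeDeriv_mul_mul_edgeDeriv Q hf, Matrix.transpose_transpose,
    Q.transpose_mul_coe_at, Matrix.trace_one, Fintype.card_fin]
  module

theorem sum_trace_edgeDeriv_mul_edgeDeriv_mul :
    ∑ D : Direction Λ N, (edgeDeriv D f Q * A * (edgeDeriv D f Q * B)).trace =
      2 * ((Aᵀ * B).trace - (A * (Q.at f).1).trace * ((Q.at f).1 * B).trace) := by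
  simp only [← mul_assoc _ _ B, ← Matrix.trace_sum, ← Finset.sum_mul,
    sum_edgeDeriv_mul_mul_edgeDeriv Q hf, Matrix.smul_mul, sub_mul, Matrix.trace_smul,
    Matrix.trace_sub, smul_eq_mul]

theorem sum_trace_edgeDeriv_mul_edgeDeriv_inv_mul :
    ∑ D : Direction Λ N, (edgeDeriv D f Q * A * (edgeDeriv D f⁻¹ Q * B)).trace =
      2 * (A.trace * B.trace - ((Q.at f).1 * Aᵀ * (Q.at f⁻¹).1 * B).trace) := by
  simp only [edgeDeriv_inv, ← mul_assoc _ _ B, ← Matrix.trace_sum, ← Finset.sum_mul,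
    sum_edgeDeriv_mul_mul_transpose_edgeDeriv Q hf, Q.coe_at_inv, Matrix.smul_mul, sub_mul, one_mul,
    Matrix.trace_smul, Matrix.trace_sub, smul_eq_mul]

theorem sum_trace_edgeDeriv_mul_trace_edgeDeriv :
    ∑ D : Direction Λ N, (edgeDeriv D f Q * A).trace * (edgeDeriv D f Q * B).trace =
      2 * ((Bᵀ * A).trace - ((Q.at f).1 * B * (Q.at f).1 * A).trace) := by
  have contraction := congrArg (fun M => (M * A).trace)
    (sum_trace_edgeDeriv_mul_smul_edgeDeriv Q hf B)
  simpa only [Finset.sum_mul, Matrix.smul_mul, Matrix.trace_sum, Matrix.trace_smul, smul_eq_mul,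
    sub_mul, Matrix.trace_sub, mul_comm (edgeDeriv _ f Q * B).trace] using contraction

theorem sum_trace_edgeDeriv_mul_trace_edgeDeriv_inv :
    ∑ D : Direction Λ N, (edgeDeriv D f Q * A).trace * (edgeDeriv D f⁻¹ Q * B).trace =
      2 * ((B * A).trace - ((Q.at f).1 * Bᵀ * (Q.at f).1 * A).trace) := by
  simpa only [trace_edgeDeriv_inv_mul, Matrix.transpose_transpose] using
    sum_trace_edgeDeriv_mul_trace_edgeDeriv Q hf A Bᵀ

end Contraction

/-! ### Sums over the locations of a list -/

section Locations

variable {α M : Type*} [CommMonoid M]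

@[to_additive]
theorem prod_getElem_append (σ τ : List α) (F : ℕ → α → M) :
    ∏ y : Fin (σ ++ τ).length, F y (σ ++ τ)[y] =
      (∏ i : Fin σ.length, F i σ[i]) * ∏ j : Fin τ.length, F (σ.length + j) τ[j] := by
  induction σ generalizing F with
  | nil => simp
  | cons a σ ih =>
    have step := ih fun y => F (y + 1)
    simp only [Fin.getElem_fin] at step
    simp [Fin.prod_univ_succ, step, mul_assoc, Nat.add_right_comm _ 1]

@[to_additive]
theorem prod_erase_getElem_append_cons (σ τ : List α) (a : α)
    (h : σ.length < (σ ++ a :: τ).length) (F : ℕ → α → M) :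
    ∏ y ∈ Finset.univ.erase (⟨σ.length, h⟩ : Fin (σ ++ a :: τ).length), F y (σ ++ a :: τ)[y] =
      (∏ i : Fin σ.length, F i σ[i]) * ∏ j : Fin τ.length, F (σ.length + (j + 1)) τ[j] := by
  have eq_ite (y : Fin (σ ++ a :: τ).length) (hy : y ∈ Finset.univ.erase ⟨σ.length, h⟩) :
      F y (σ ++ a :: τ)[y] = if (y : ℕ) = σ.length then 1 else F y (σ ++ a :: τ)[y] :=
    (if_neg fun hyσ => (Finset.mem_erase.1 hy).1 (Fin.ext hyσ)).symm
  rw [Finset.prod_congr rfl eq_ite,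
    Finset.prod_erase
      (f := fun y : Fin _ => if (y : ℕ) = σ.length then 1 else F y (σ ++ a :: τ)[y]) _
      (if_pos rfl),
    prod_getElem_append σ (a :: τ) fun y b => if y = σ.length then 1 else F y b]
  simp [Fin.prod_univ_succ, fun i : Fin σ.length => i.2.ne]

theorem prod_map_eraseIdx (L : List α) (k : Fin L.length) (f : α → M) :
    ((L.eraseIdx k).map f).prod = ∏ j ∈ Finset.univ.erase k, f L[j] := by
  obtain ⟨k, hk⟩ := k
  obtain ⟨σ, a, τ, rfl, rfl⟩ : ∃ σ a τ, L = σ ++ a :: τ ∧ k = σ.length :=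
    ⟨L.take k, L[k], L.drop (k + 1), by simp, by simp [hk.le]⟩
  rw [prod_erase_getElem_append_cons σ τ a hk fun _ => f]
  simp [List.eraseIdx_append_of_length_le, Fin.prod_univ_fun_getElem]

theorem prod_map_set_eraseIdx (L : List α) {k r : Fin L.length} (h : k ≠ r) (a : α) (f : α → M) :
    (((L.set k a).eraseIdx r).map f).prod =
      f a * ∏ j ∈ (Finset.univ.erase k).erase r, f L[j] := by
  have apply_set (j : Fin L.length) :
      f ((L.set k a)[(j : ℕ)]'(by simp)) = if j = k then f a else f L[j] := by
    simp only [List.getElem_set, Fin.ext_iff, eq_comm (a := (k : ℕ)), apply_ite f, Fin.getElem_fin]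
  have length_set : L.length = (L.set k a).length := List.length_set.symm
  calc (((L.set k a).eraseIdx r).map f).prod
      = ∏ j ∈ Finset.univ.erase (r.cast length_set), f (L.set k a)[j] :=
        prod_map_eraseIdx _ (r.cast length_set) f
    _ = ∏ j ∈ Finset.univ.erase r, if j = k then f a else f L[j] :=
        (Finset.prod_equiv (finCongr length_set) (by simp [Fin.ext_iff])
          fun j _ => (apply_set j).symm).symm
    _ = _ := by
        rw [← Finset.mul_prod_erase _ _ (Finset.mem_erase.2 ⟨h, Finset.mem_univ k⟩), if_pos rfl,
          Finset.erase_right_comm]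
        exact congrArg _ (Finset.prod_congr rfl fun j hj => if_neg (by grind))

end Locations

theorem sum_arc_self {M : Type*} [AddCommMonoid M] (ρ : List (Edge d)) (x : Fin ρ.length)
    (F : List (Edge d) → Edge d → List (Edge d) → M) :
    ∑ j : Fin (arc ρ x x).length,
      F ((arc ρ x x).take j) (arc ρ x x)[j] ((arc ρ x x).drop (j + 1)) =
    ∑ y ∈ Finset.univ.erase x, F (arc ρ x y) ρ[y] (arc ρ y x) := by
  obtain ⟨x, hx⟩ := x
  obtain ⟨a, e, b, rfl, rfl⟩ : ∃ a e b, ρ = a ++ e :: b ∧ x = a.length :=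
    ⟨ρ.take x, ρ[x], ρ.drop (x + 1), by simp, by simp [hx.le]⟩
  have sum_of_eq_append (σ : List (Edge d)) (hσ : σ = b ++ a) :
      ∑ j : Fin σ.length, F (σ.take j) σ[j] (σ.drop (j + 1)) =
        (∑ j : Fin b.length, F (b.take j) b[j] (b.drop (j + 1) ++ a)) +
          ∑ i : Fin a.length, F (b ++ a.take i) a[i] (a.drop (i + 1)) := by
    subst hσ
    rw [sum_getElem_append b a fun j f => F ((b ++ a).take j) f ((b ++ a).drop (j + 1))]
    congr! 3 with j _ i _
    · exact List.take_append_of_le_length j.2.le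
    · exact List.drop_append_of_le_length j.2
    · exact List.take_length_add_append i
    · exact List.drop_length_add_append (i + 1)
  rw [sum_of_eq_append _ (by simp [arc]),
    sum_erase_getElem_append_cons a b e hx fun y f =>
      F (arc (a ++ e :: b) a.length y) f (arc (a ++ e :: b) y a.length), add_comm]
  congr! 3 with i _ j _
  · simp [arc, i.2.not_gt, List.take_append_of_le_length i.2.le]
  · simp [arc, i.2, List.drop_append_of_le_length (Nat.succ_le_of_lt i.2)]
  · simp [arc, show a.length + (j + 1) - (a.length + 1) = j by lia]
  · simp [arc, List.drop_append, show a.length + (j + 1) + 1 - a.length = j + 1 + 1 by lia,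
      show a.length ≤ a.length + (j + 1) + 1 by lia]

/-! ### Traces along paths -/

/-- The derivative of `Tr Q_ρ` in the direction `D`. -/
noncomputable def traceDeriv (D : Direction Λ N) (ρ : List (Edge d)) (Q : Config Λ N) : ℝ :=
  ∑ x : Fin ρ.length, (edgeDeriv D ρ[x] Q * holonomy Q (arc ρ x x)).trace

/-- The second derivative of `Tr Q_ρ` in the direction `D`. -/
noncomputable def traceDerivTwo (D : Direction Λ N) (ρ : List (Edge d)) (Q : Config Λ N) : ℝ :=
  ∑ x : Fin ρ.length, ((edgeDerivTwo D ρ[x] Q * holonomy Q (arc ρ x x)).trace +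
    ∑ y ∈ Finset.univ.erase x, (edgeDeriv D ρ[x] Q * holonomy Q (arc ρ x y) *
      (edgeDeriv D ρ[y] Q * holonomy Q (arc ρ y x))).trace)

theorem continuous_pathTrace (ρ : List (Edge d)) :
    Continuous fun Q : Config Λ N => pathTrace Q ρ :=
  (continuous_subtype_val.comp
    (continuous_list_prod _ fun e _ => Config.continuous_at e)).matrix_trace

theorem hasLieDeriv_pathTrace (ρ : List (Edge d)) :
    HasLieDeriv (flow D) (fun Q => pathTrace Q ρ) (traceDeriv D ρ) := by
  refine (hasMatrixLieDeriv_holonomy D ρ).trace.congr_deriv fun Q => ?_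
  rw [Matrix.trace_sum, traceDeriv]
  refine Finset.sum_congr rfl fun x _ => ?_
  rw [mul_assoc, Matrix.trace_mul_comm, mul_assoc, ← holonomy_append, arc, if_neg (lt_irrefl _)]

theorem hasLieDeriv_traceDeriv (ρ : List (Edge d)) :
    HasLieDeriv (flow D) (traceDeriv D ρ) (traceDerivTwo D ρ) := by
  refine (HasLieDeriv.sum (s := Finset.univ) fun (x : Fin ρ.length) _ =>
    ((hasMatrixLieDeriv_edgeDeriv D ρ[x]).mul
      (hasMatrixLieDeriv_holonomy D (arc ρ x x))).trace).congr_deriv fun Q => ?_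
  refine Finset.sum_congr rfl fun x _ => ?_
  rw [Matrix.trace_add, Finset.mul_sum, Matrix.trace_sum,
    ← sum_arc_self ρ x fun σ f τ => (edgeDeriv D ρ[x] Q * holonomy Q σ *
      (edgeDeriv D f Q * holonomy Q τ)).trace]
  simp only [mul_assoc]

theorem pathTrace_eq_arc (Q : Config Λ N) (ρ : List (Edge d)) (x : Fin ρ.length) :
    pathTrace Q ρ = ((Q.at ρ[x]).1 * holonomy Q (arc ρ x x)).trace := by
  rw [pathTrace_congr Q _ _ (Cycle.coe_eq_coe.1 (coe_eq_arc ρ x)), pathTrace_eq, holonomy_cons]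

theorem pathTrace_cons_inv_cons (Q : Config Λ N) (e : Edge d) (ρ : List (Edge d)) :
    pathTrace Q (e :: e⁻¹ :: ρ) = pathTrace Q ρ := by
  rw [pathTrace_eq, holonomy_cons, holonomy_cons, ← mul_assoc, Q.coe_at_inv,
    Q.coe_at_mul_transpose, one_mul, pathTrace_eq]

/-! ### Wilson loop variables -/

/-- The Wilson loop variable `W_l / N`, which equals `1` for the null loop. -/
noncomputable def normalizedWilson (Q : Config Λ N) (l : Loop d) : ℝ := wilson Q l / N

theorem wilson_eq_pathTrace (Q : Config Λ N) (l : Loop d) : wilson Q l = pathTrace Q l.path := by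
  rw [wilson, ← l.coe_path]
  rfl

theorem wilson_coreLoop (Q : Config Λ N) (ρ : List (Edge d))
    (h : IsClosed (ρ : Cycle (Edge d))) : wilson Q (coreLoop ρ h) = pathTrace Q ρ := by
  let cycleTrace : Cycle (Edge d) → ℝ := Quotient.lift (s := List.IsRotated.setoid _)
    (pathTrace Q) fun ρ ρ' h => pathTrace_congr Q ρ ρ' h
  have cycleTrace_eq (c c' : Cycle (Edge d)) (hc : Relation.ReflTransGen Erase c c') :
      cycleTrace c' = cycleTrace c := by
    induction hc with
    | refl => rfl
    | tail _ erase ih =>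
      obtain ⟨e, σ, rfl, rfl⟩ := erase
      exact (pathTrace_cons_inv_cons Q e σ).symm.trans ih
  exact cycleTrace_eq _ _ (core_spec _).1

theorem wilson_null (Q : Config Λ N) : wilson Q (Loop.null d) = N := by
  change (holonomy Q []).trace = N
  rw [holonomy_nil, Matrix.trace_one, Fintype.card_fin]

theorem Loop.length_path (l : Loop d) : l.path.length = l.length := by
  rw [Loop.length, ← l.coe_path, Cycle.length_coe]

theorem continuous_normalizedWilson (l : Loop d) :
    Continuous fun Q : Config Λ N => normalizedWilson Q l := by
  simpa only [normalizedWilson, wilson_eq_pathTrace] using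
    (continuous_pathTrace l.path).div_const (N : ℝ)

theorem hasLieDeriv_normalizedWilson (l : Loop d) :
    HasLieDeriv (flow D) (fun Q => normalizedWilson Q l) (fun Q => traceDeriv D l.path Q / N) := by
  simpa only [normalizedWilson, wilson_eq_pathTrace] using
    (hasLieDeriv_pathTrace D l.path).div_const N

/-! ### The operations on loops as contractions -/

open scoped Classical in
theorem sum_trace_arc_mul_arc (Q : Config Λ N) (l : Loop d) {x y : Fin l.path.length}
    (hxy : x ≠ y) (hx : l.path[x].InLattice Λ) (hN : N ≠ 0) :
    (∑ D : Direction Λ N, (edgeDeriv D l.path[x] Q * holonomy Q (arc l.path x y) *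
        (edgeDeriv D l.path[y] Q * holonomy Q (arc l.path y x))).trace) / N =
      2 * ((if h : SameAt l.path x y then normalizedWilson Q (l.negTwist x y h) else 0) -
        (if h : InvAt l.path x y then normalizedWilson Q (l.posTwist x y h) else 0) +
        N * (if h : InvAt l.path x y then normalizedWilson Q (l.negSplit₁ x y h) *
          normalizedWilson Q (l.negSplit₂ x y h) else 0) -
        N * (if h : SameAt l.path x y then normalizedWilson Q (l.posSplit₁ x y h) *
          normalizedWilson Q (l.posSplit₂ x y h) else 0)) := by
  by_cases same : l.path[y] = l.path[x]
  · have sameAt : SameAt l.path x y := ⟨hxy, same⟩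
    have not_invAt : ¬ InvAt l.path x y := fun h => l.path[x].inv_ne (h.2.symm.trans same)
    simp only [same, dif_pos sameAt, dif_neg not_invAt, normalizedWilson, Loop.negTwist,
      Loop.posSplit₁, Loop.posSplit₂, wilson_coreLoop, pathTrace_eq, holonomy_append,
      holonomy_cons, holonomy_pathInv, holonomy_nil, mul_one,
      sum_trace_edgeDeriv_mul_edgeDeriv_mul Q hx]
    field_simp
    ring
  have not_sameAt : ¬ SameAt l.path x y := fun h => same h.2
  by_cases inv : l.path[y] = l.path[x]⁻¹
  · have invAt : InvAt l.path x y := ⟨hxy, inv⟩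
    simp only [inv, dif_pos invAt, dif_neg not_sameAt, normalizedWilson, Loop.posTwist,
      Loop.negSplit₁, Loop.negSplit₂, wilson_coreLoop, pathTrace_eq, holonomy_append,
      holonomy_cons, holonomy_pathInv, ← mul_assoc (Q.at _).1,
      sum_trace_edgeDeriv_mul_edgeDeriv_inv_mul Q hx]
    field_simp
    simp only [mul_assoc]
    ring
  · have not_invAt : ¬ InvAt l.path x y := fun h => inv h.2
    rw [dif_neg not_sameAt, dif_neg not_sameAt, dif_neg not_invAt, dif_neg not_invAt,
      Finset.sum_eq_zero fun D _ => ?_]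
    · simp
    · rcases edgeDeriv_eq_zero_or D same inv Q with h | h <;>
        simp only [h, zero_mul, mul_zero, Matrix.trace_zero]

open scoped Classical in
theorem sum_traceDerivTwo_path (Q : Config Λ N) (l : Loop d) (hl : ∀ f ∈ l.path, f.InLattice Λ)
    (hN : N ≠ 0) :
    (∑ D : Direction Λ N, traceDerivTwo D l.path Q) / N =
      2 * (-((N - 1) * l.length * normalizedWilson Q l) +
        (∑ x, ∑ y, if h : SameAt l.path x y then normalizedWilson Q (l.negTwist x y h) else 0) -
        (∑ x, ∑ y, if h : InvAt l.path x y then normalizedWilson Q (l.posTwist x y h) else 0) +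
        N * (∑ x, ∑ y, if h : InvAt l.path x y then normalizedWilson Q (l.negSplit₁ x y h) *
          normalizedWilson Q (l.negSplit₂ x y h) else 0) -
        N * (∑ x, ∑ y, if h : SameAt l.path x y then normalizedWilson Q (l.posSplit₁ x y h) *
          normalizedWilson Q (l.posSplit₂ x y h) else 0)) := by
  have inLattice (x : Fin l.path.length) : l.path[x].InLattice Λ := hl _ (List.getElem_mem _)
  have diagonal (x : Fin l.path.length) : (∑ D : Direction Λ N,
      (edgeDerivTwo D l.path[x] Q * holonomy Q (arc l.path x x)).trace) / N =
        2 * (-((N - 1) * normalizedWilson Q l)) := by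
    rw [← Matrix.trace_sum, ← Finset.sum_mul, sum_edgeDerivTwo Q (inLattice x), Matrix.smul_mul,
      Matrix.trace_smul, ← pathTrace_eq_arc, normalizedWilson, wilson_eq_pathTrace, smul_eq_mul]
    ring
  have offDiagonal (x : Fin l.path.length) : (∑ D : Direction Λ N, ∑ y ∈ Finset.univ.erase x,
      (edgeDeriv D l.path[x] Q * holonomy Q (arc l.path x y) *
        (edgeDeriv D l.path[y] Q * holonomy Q (arc l.path y x))).trace) / N =
      ∑ y, 2 * ((if h : SameAt l.path x y then normalizedWilson Q (l.negTwist x y h) else 0) -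
        (if h : InvAt l.path x y then normalizedWilson Q (l.posTwist x y h) else 0) +
        N * (if h : InvAt l.path x y then normalizedWilson Q (l.negSplit₁ x y h) *
          normalizedWilson Q (l.negSplit₂ x y h) else 0) -
        N * (if h : SameAt l.path x y then normalizedWilson Q (l.posSplit₁ x y h) *
          normalizedWilson Q (l.posSplit₂ x y h) else 0)) := by
    have not_sameAt : ¬ SameAt l.path x x := fun h => h.1 rfl
    have not_invAt : ¬ InvAt l.path x x := fun h => h.1 rfl
    rw [Finset.sum_comm, Finset.sum_div, ← Finset.sum_erase Finset.univ (a := x)]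
    · exact Finset.sum_congr rfl fun y hy =>
        sum_trace_arc_mul_arc Q l (Finset.ne_of_mem_erase hy).symm (inLattice x) hN
    · simp only [dif_neg not_sameAt, dif_neg not_invAt, mul_zero, sub_zero, add_zero]
  simp only [traceDerivTwo]
  rw [Finset.sum_comm, Finset.sum_div]
  simp only [Finset.sum_add_distrib, add_div, diagonal, offDiagonal, ← Finset.mul_sum,
    Finset.sum_sub_distrib, Finset.sum_const, Finset.card_univ, Fintype.card_fin, l.length_path,
    nsmul_eq_mul]
  ring

open scoped Classical in
theorem sum_trace_arc_mul_trace_arc (Q : Config Λ N) {ρ ρ' : List (Edge d)}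
    (hρ : IsClosed (ρ : Cycle (Edge d))) (hρ' : IsClosed (ρ' : Cycle (Edge d))) (x : Fin ρ.length)
    (y : Fin ρ'.length) (hx : ρ[x].InLattice Λ) (hN : N ≠ 0) :
    ∑ D : Direction Λ N, (edgeDeriv D ρ[x] Q * holonomy Q (arc ρ x x)).trace *
        (edgeDeriv D ρ'[y] Q * holonomy Q (arc ρ' y y)).trace =
      2 * N * ((if h : Parallel ρ ρ' x y then
          normalizedWilson Q (negMerge ρ ρ' hρ hρ' x y h) else 0) -
        (if h : Parallel ρ ρ' x y then
          normalizedWilson Q (posMerge ρ ρ' hρ hρ' x y h) else 0)) := by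
  by_cases parallel : Parallel ρ ρ' x y
  · simp only [dif_pos parallel, normalizedWilson, negMerge, posMerge, wilson_coreLoop,
      pathTrace_eq]
    by_cases same : ρ'[y] = ρ[x]
    · simp only [if_pos same, holonomy_append, holonomy_cons, holonomy_pathInv]
      rw [same, sum_trace_edgeDeriv_mul_trace_edgeDeriv Q hx]
      field_simp
      simp only [mul_assoc]
    · simp only [if_neg same, holonomy_append, holonomy_cons, holonomy_pathInv]
      rw [parallel.resolve_left same, sum_trace_edgeDeriv_mul_trace_edgeDeriv_inv Q hx]
      field_simp
      simp only [mul_assoc]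
  · obtain ⟨not_same, not_inv⟩ := not_or.1 parallel
    rw [dif_neg parallel, dif_neg parallel, Finset.sum_eq_zero fun D _ => ?_]
    · simp
    · rcases edgeDeriv_eq_zero_or D not_same not_inv Q with h | h <;>
        simp only [h, zero_mul, mul_zero, Matrix.trace_zero]

open scoped Classical in
theorem sum_trace_arc_mul_traceDeriv (Q : Config Λ N) {ρ ρ' : List (Edge d)}
    (hρ : IsClosed (ρ : Cycle (Edge d))) (hρ' : IsClosed (ρ' : Cycle (Edge d))) (x : Fin ρ.length)
    (hx : ρ[x].InLattice Λ) (hN : N ≠ 0) :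
    ∑ D : Direction Λ N, (edgeDeriv D ρ[x] Q * holonomy Q (arc ρ x x)).trace * traceDeriv D ρ' Q =
      2 * N * ((∑ y, if h : Parallel ρ ρ' x y then
          normalizedWilson Q (negMerge ρ ρ' hρ hρ' x y h) else 0) -
        ∑ y, if h : Parallel ρ ρ' x y then
          normalizedWilson Q (posMerge ρ ρ' hρ hρ' x y h) else 0) := by
  simp only [traceDeriv, Finset.mul_sum]
  rw [Finset.sum_comm]
  simp only [sum_trace_arc_mul_trace_arc Q hρ hρ' x _ hx hN, ← Finset.mul_sum,
    Finset.sum_sub_distrib]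

open scoped Classical in
theorem sum_traceDeriv_mul_traceDeriv (Q : Config Λ N) {ρ ρ' : List (Edge d)}
    (hρ : IsClosed (ρ : Cycle (Edge d))) (hρ' : IsClosed (ρ' : Cycle (Edge d)))
    (hρΛ : ∀ f ∈ ρ, f.InLattice Λ) (hN : N ≠ 0) :
    ∑ D : Direction Λ N, traceDeriv D ρ Q * traceDeriv D ρ' Q =
      2 * N * ((∑ x, ∑ y, if h : Parallel ρ ρ' x y then
          normalizedWilson Q (negMerge ρ ρ' hρ hρ' x y h) else 0) -
        ∑ x, ∑ y, if h : Parallel ρ ρ' x y then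
          normalizedWilson Q (posMerge ρ ρ' hρ hρ' x y h) else 0) := by
  simp only [traceDeriv.eq_def _ ρ, Finset.sum_mul]
  rw [Finset.sum_comm]
  simp only [sum_trace_arc_mul_traceDeriv Q hρ hρ' _ (hρΛ _ (List.getElem_mem _)) hN,
    ← Finset.mul_sum, Finset.sum_sub_distrib]

/-! ### Plaquettes and locality -/

/-- All points at lattice distance at most one from the end points of `f` belong to `Λ`. -/
def NeighborhoodIn (Λ : Finset (Fin d → ℤ)) (f : Edge d) : Prop :=
  ∀ v, v = f.src ∨ v = f.tgt → ∀ w : Fin d → ℤ, ∑ i, |w i - v i| ≤ 1 → w ∈ Λ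

namespace NeighborhoodIn

variable {f g : Edge d}

theorem inLattice (h : NeighborhoodIn Λ f) : f.InLattice Λ :=
  ⟨h _ (.inl rfl) _ (by simp), h _ (.inr rfl) _ (by simp)⟩

theorem inv (h : NeighborhoodIn Λ f) : NeighborhoodIn Λ f⁻¹ := fun v hv => h v hv.symm

theorem tgt_mem (h : NeighborhoodIn Λ f) (hg : g.src = f.tgt) : g.tgt ∈ Λ :=
  h _ (.inr rfl) _ (hg ▸ g.adj.le)

theorem src_mem (h : NeighborhoodIn Λ f) (hg : g.tgt = f.src) : g.src ∈ Λ :=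
  h _ (.inl rfl) _ (hg ▸ g⁻¹.adj.le)

/-- The two vertices of a plaquette that do not lie on `f` are neighbours of end points of `f`. -/
theorem inLattice_of_mem (h : NeighborhoodIn Λ f) {p : List (Edge d)} (hp : p.length = 4)
    (hc : IsClosed (p : Cycle (Edge d))) (hf : f ∈ p) (hg : g ∈ p) : g.InLattice Λ := by
  obtain ⟨x, rfl⟩ : ∃ x : Fin p.length, p[x] = f :=
    let ⟨i, hi, hif⟩ := List.getElem_of_mem hf; ⟨⟨i, hi⟩, hif⟩
  have length_arc : (p[x] :: arc p x x).length = 4 :=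
    hp ▸ (Cycle.coe_eq_coe.1 (coe_eq_arc p x)).perm.length_eq.symm
  obtain ⟨f₂, f₃, f₄, harc⟩ := List.length_eq_three.1 (Nat.succ.inj length_arc)
  rw [coe_eq_arc p x, harc] at hc
  obtain ⟨h₁₂, h₂₃, h₃₄, h₄₁⟩ := isClosed_cons.1 hc
  have mem_arc : g ∈ [p[x], f₂, f₃, f₄] :=
    harc ▸ (Cycle.coe_eq_coe.1 (coe_eq_arc p x)).perm.mem_iff.1 hg
  have f₂_tgt := h.tgt_mem h₁₂
  have f₄_src := h.src_mem h₄₁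
  simp only [List.mem_cons, List.not_mem_nil, or_false] at mem_arc
  rcases mem_arc with rfl | rfl | rfl | rfl
  · exact h.inLattice
  · exact ⟨h₁₂ ▸ h.inLattice.2, f₂_tgt⟩
  · exact ⟨h₂₃ ▸ f₂_tgt, h₃₄ ▸ f₄_src⟩
  · exact ⟨f₄_src, h₄₁ ▸ h.inLattice.1⟩

end NeighborhoodIn

theorem posPlaquettesAt_subset {f : Edge d} (h : NeighborhoodIn Λ f) :
    posPlaquettesAt f ⊆ posPlaquettesIn Λ := by
  intro p hp
  obtain ⟨hp, hf⟩ := (finite_posPlaquettesAt f).mem_toFinset.1 hp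
  exact (finite_posPlaquettesIn Λ).mem_toFinset.2 ⟨hp, fun g hg => hf.elim
    (fun hf => h.inLattice_of_mem hp.1.1 hp.1.2.1 hf hg)
    (fun hf => h.inv.inLattice_of_mem hp.1.1 hp.1.2.1 hf hg)⟩

theorem isClosed_of_mem_posPlaquettesIn {p : List (Edge d)} (h : p ∈ posPlaquettesIn Λ) :
    IsClosed (p : Cycle (Edge d)) :=
  ((finite_posPlaquettesIn Λ).mem_toFinset.1 h).1.1.2.1

theorem mem_posPlaquettesAt_of_parallel {ρ p : List (Edge d)} (hp : p ∈ posPlaquettesIn Λ)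
    {x : Fin ρ.length} {y : Fin p.length} (h : Parallel ρ p x y) : p ∈ posPlaquettesAt ρ[x] :=
  (finite_posPlaquettesAt _).mem_toFinset.2
    ⟨((finite_posPlaquettesIn Λ).mem_toFinset.1 hp).1,
      h.imp (fun h : p[y] = ρ[x] => h ▸ List.getElem_mem _)
        fun h : p[y] = ρ[x]⁻¹ => h ▸ List.getElem_mem _⟩

open scoped Classical in
theorem sum_traceDeriv_mul_sum_plaquettes (Q : Config Λ N) {ρ : List (Edge d)}
    (hρ : IsClosed (ρ : Cycle (Edge d))) (hρΛ : ∀ f ∈ ρ, NeighborhoodIn Λ f) (hN : N ≠ 0) :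
    ∑ D : Direction Λ N, traceDeriv D ρ Q * ∑ p ∈ posPlaquettesIn Λ, traceDeriv D p Q =
      2 * N * ((∑ x : Fin ρ.length, ∑ p ∈ (posPlaquettesAt ρ[x]).attach, ∑ y,
          if h : Parallel ρ p.1 x y then normalizedWilson Q
            (negMerge ρ p.1 hρ (isClosed_of_mem_posPlaquettesAt p.2) x y h) else 0) -
        ∑ x : Fin ρ.length, ∑ p ∈ (posPlaquettesAt ρ[x]).attach, ∑ y,
          if h : Parallel ρ p.1 x y then normalizedWilson Q
            (posMerge ρ p.1 hρ (isClosed_of_mem_posPlaquettesAt p.2) x y h) else 0) := by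
  have neighborhoodIn (x : Fin ρ.length) : NeighborhoodIn Λ ρ[x] := hρΛ _ (List.getElem_mem _)
  let contraction (x : Fin ρ.length) (p : List (Edge d)) : ℝ := ∑ D : Direction Λ N,
    (edgeDeriv D ρ[x] Q * holonomy Q (arc ρ x x)).trace * traceDeriv D p Q
  have restrict (x : Fin ρ.length) : ∑ p ∈ posPlaquettesIn Λ, contraction x p =
      ∑ p ∈ (posPlaquettesAt ρ[x]).attach, contraction x p := by
    rw [Finset.sum_attach _ (contraction x)]
    refine (Finset.sum_subset (posPlaquettesAt_subset (neighborhoodIn x)) fun p hp hpx => ?_).symm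
    have not_parallel (y : Fin p.length) : ¬ Parallel ρ p x y := fun h =>
      hpx (mem_posPlaquettesAt_of_parallel hp h)
    simp only [contraction, sum_trace_arc_mul_traceDeriv Q hρ (isClosed_of_mem_posPlaquettesIn hp)
      x (neighborhoodIn x).inLattice hN, dif_neg (not_parallel _), sub_self, mul_zero]
  have expand : ∑ D : Direction Λ N, traceDeriv D ρ Q * ∑ p ∈ posPlaquettesIn Λ, traceDeriv D p Q =
      ∑ x, ∑ p ∈ posPlaquettesIn Λ, contraction x p := by
    simp only [traceDeriv.eq_def _ ρ, Finset.sum_mul]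
    rw [Finset.sum_comm]
    refine Finset.sum_congr rfl fun x _ => ?_
    simp only [Finset.mul_sum]
    exact Finset.sum_comm
  have contraction_eq (x : Fin ρ.length) (p : posPlaquettesAt ρ[x]) :=
    sum_trace_arc_mul_traceDeriv Q hρ (isClosed_of_mem_posPlaquettesAt p.2) x
      (neighborhoodIn x).inLattice hN
  simp only [expand, restrict, contraction, contraction_eq, ← Finset.mul_sum,
    Finset.sum_sub_distrib]

/-! ### Expectations -/

instance (N : ℕ) : SecondCountableTopology (SO N) :=
  haveI : SecondCountableTopology (Matrix (Fin N) (Fin N) ℝ) :=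
    inferInstanceAs (SecondCountableTopology (Fin N → Fin N → ℝ))
  TopologicalSpace.Subtype.secondCountableTopology _

instance (N : ℕ) : Measure.IsHaarMeasure (haarSO N) :=
  inferInstanceAs (Measure.IsHaarMeasure (Measure.haarMeasure ⊤))

instance (N : ℕ) : IsProbabilityMeasure (haarSO N) :=
  ⟨Measure.haarMeasure_self (K₀ := (⊤ : TopologicalSpace.PositiveCompacts (SO N)))⟩

instance : BorelSpace (Config Λ N) := Pi.borelSpace

theorem integrable_of_continuous {μ : Measure (Config Λ N)} [IsFiniteMeasure μ]
    {f : Config Λ N → ℝ} (hf : Continuous f) : Integrable f μ :=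
  hf.integrable_of_hasCompactSupport (.of_compactSpace f)

/-- The derivative of `N β ∑ Tr Q_p`, the logarithm of `gaugeWeight`, in the direction `D`. -/
noncomputable def actionDeriv (β : ℝ) (Q : Config Λ N) : ℝ :=
  N * β * ∑ p ∈ posPlaquettesIn Λ, traceDeriv D p Q

theorem continuous_actionDeriv (β : ℝ) : Continuous (actionDeriv D β) :=
  continuous_const.mul (continuous_finsetSum _ fun p _ =>
    (hasLieDeriv_pathTrace D p).continuous_deriv)

theorem hasLieDeriv_gaugeWeight (β : ℝ) : HasLieDeriv (flow D) (gaugeWeight Λ N β)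
    (fun Q => gaugeWeight Λ N β Q * actionDeriv D β Q) :=
  ((HasLieDeriv.sum fun p _ => hasLieDeriv_pathTrace D p).const_mul (N * β)).exp

theorem continuous_gaugeWeight (β : ℝ) : Continuous (gaugeWeight Λ N β) :=
  (continuous_const.mul (continuous_finsetSum _ fun p _ => continuous_pathTrace p)).rexp

theorem integral_gaugeMeasure (β : ℝ) (f : Config Λ N → ℝ) :
    ∫ Q, f Q ∂gaugeMeasure Λ N β =
      (partitionFunction Λ N β)⁻¹ * ∫ Q, f Q * gaugeWeight Λ N β Q ∂.pi fun _ => haarSO N := by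
  have density_nonneg (Q : Config Λ N) : 0 ≤ (partitionFunction Λ N β)⁻¹ * gaugeWeight Λ N β Q :=
    mul_nonneg (inv_nonneg.2 (integral_nonneg fun _ => Real.exp_nonneg _)) (Real.exp_nonneg _)
  have measurable_density : Measurable fun Q : Config Λ N =>
      ENNReal.ofReal ((partitionFunction Λ N β)⁻¹ * gaugeWeight Λ N β Q) :=
    (continuous_const.mul (continuous_gaugeWeight β)).measurable.ennreal_ofReal
  rw [gaugeMeasure, integral_withDensity_eq_integral_toReal_smul measurable_density
    (.of_forall fun _ => ENNReal.ofReal_lt_top), ← integral_const_mul]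
  simp only [ENNReal.toReal_ofReal (density_nonneg _), smul_eq_mul, mul_assoc,
    mul_comm (gaugeWeight Λ N β _)]

instance (β : ℝ) : IsFiniteMeasure (gaugeMeasure Λ N β) :=
  isFiniteMeasure_withDensity_ofReal
    (integrable_of_continuous (continuous_const.mul (continuous_gaugeWeight β))).2

variable {D} in
/-- The Schwinger–Dyson equation: the Lie derivative of `f * gaugeWeight` has integral zero. -/
theorem integral_add_mul_actionDeriv_eq_zero {f f' : Config Λ N → ℝ}
    (h : HasLieDeriv (flow D) f f') (β : ℝ) :
    ∫ Q, f' Q + f Q * actionDeriv D β Q ∂gaugeMeasure Λ N β = 0 := by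
  have lieDeriv_mul_gaugeWeight := (h.mul (hasLieDeriv_gaugeWeight D β)).congr_deriv
    (f₂' := fun Q => (f' Q + f Q * actionDeriv D β Q) * gaugeWeight Λ N β Q) fun Q => by ring
  rw [integral_gaugeMeasure, lieDeriv_mul_gaugeWeight.integral_eq_zero, mul_zero]

/-- The expectation of continuous functions under the gauge measure. -/
noncomputable def expectation (Λ : Finset (Fin d → ℤ)) (N : ℕ) (β : ℝ) :
    C(Config Λ N, ℝ) →ₗ[ℝ] ℝ where
  toFun F := ∫ Q, F Q ∂gaugeMeasure Λ N β
  map_add' F G := integral_add (integrable_of_continuous F.continuous)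
    (integrable_of_continuous G.continuous)
  map_smul' a _ := integral_const_mul a _

/-! ### Observables of loop sequences -/

/-- The random variable `W_{l_1} ⋯ W_{l_n} / N^n`, whose expectation is `phi Λ N β s`. -/
noncomputable def observable (Λ : Finset (Fin d → ℤ)) (N : ℕ) (s : LoopSeq d) :
    C(Config Λ N, ℝ) where
  toFun Q := (s.minRep.map (normalizedWilson Q)).prod
  continuous_toFun := continuous_list_prod _ fun l _ => continuous_normalizedWilson l

theorem expectation_observable (β : ℝ) (s : LoopSeq d) :
    expectation Λ N β (observable Λ N s) = phi Λ N β s := by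
  have prod_normalizedWilson (L : List (Loop d)) (Q : Config Λ N) :
      (L.map (normalizedWilson Q)).prod = (L.map (wilson Q)).prod / N ^ L.length := by
    induction L with
    | nil => simp
    | cons l L ih => simp [ih, normalizedWilson, pow_succ', div_mul_div_comm]
  change ∫ Q, (s.minRep.map (normalizedWilson Q)).prod ∂gaugeMeasure Λ N β = _
  simp only [prod_normalizedWilson, phi, integral_div]

theorem observable_mk (hN : N ≠ 0) (L : List (Loop d)) (Q : Config Λ N) :
    observable Λ N (LoopSeq.mk L) Q = (L.map (normalizedWilson Q)).prod := by
  have normalizedWilson_null : normalizedWilson Q (Loop.null d) = 1 := by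
    rw [normalizedWilson, wilson_null, div_self (Nat.cast_ne_zero.2 hN)]
  change ((dropNull L).map (normalizedWilson Q)).prod = _
  induction L with
  | nil => rfl
  | cons l L ih =>
    by_cases h : l = Loop.null d
    · rw [dropNull, List.filter_cons_of_neg (by simpa using h), ← dropNull, ih, h, List.map_cons,
        List.prod_cons, normalizedWilson_null, one_mul]
    · rw [dropNull, List.filter_cons_of_pos (by simpa using h), ← dropNull, List.map_cons,
        List.prod_cons, ih, List.map_cons, List.prod_cons]

/-- The sum of the observables of a collection of loop sequences. -/
noncomputable def observableSum (Λ : Finset (Fin d → ℤ)) (N : ℕ) :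
    Multiset (LoopSeq d) →+ C(Config Λ N, ℝ) :=
  Multiset.sumAddMonoidHom.comp (Multiset.mapAddMonoidHom (observable Λ N))

theorem expectation_observableSum (β : ℝ) (m : Multiset (LoopSeq d)) :
    expectation Λ N β (observableSum Λ N m) = (m.map (phi Λ N β)).sum := by
  rw [observableSum, AddMonoidHom.comp_apply, Multiset.coe_sumAddMonoidHom,
    Multiset.coe_mapAddMonoidHom, map_multiset_sum, Multiset.map_map]
  simp only [Function.comp_def, expectation_observable]

theorem observable_eq_prod (s : LoopSeq d) (Q : Config Λ N) :
    observable Λ N s Q = ∏ k : Fin s.minRep.length, normalizedWilson Q s.minRep[k] :=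
  (Fin.prod_univ_fun_getElem s.minRep (normalizedWilson Q)).symm

theorem observable_replace (hN : N ≠ 0) (s : LoopSeq d) (k : Fin s.minRep.length)
    (L : List (Loop d)) (Q : Config Λ N) : observable Λ N (s.replace k L) Q =
      (L.map (normalizedWilson Q)).prod *
        ∏ j ∈ Finset.univ.erase k, normalizedWilson Q s.minRep[j] := by
  rw [LoopSeq.replace, observable_mk hN, ← prod_map_eraseIdx, List.eraseIdx_eq_take_drop_succ]
  simp only [List.map_append, List.prod_append]
  ring

theorem observable_replaceRemove (hN : N ≠ 0) (s : LoopSeq d) {k r : Fin s.minRep.length}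
    (h : k ≠ r) (l : Loop d) (Q : Config Λ N) : observable Λ N (s.replaceRemove k r l) Q =
      normalizedWilson Q l *
        ∏ j ∈ (Finset.univ.erase k).erase r, normalizedWilson Q s.minRep[j] := by
  rw [LoopSeq.replaceRemove, observable_mk hN, prod_map_set_eraseIdx _ h]

open scoped Classical in
theorem observableSum_dite_replace (hN : N ≠ 0) (s : LoopSeq d) (k : Fin s.minRep.length)
    {p : Prop} (L : p → List (Loop d)) (Q : Config Λ N) :
    observableSum Λ N (if h : p then {s.replace k (L h)} else 0) Q =
      (if h : p then ((L h).map (normalizedWilson Q)).prod else 0) *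
        ∏ j ∈ Finset.univ.erase k, normalizedWilson Q s.minRep[j] := by
  split_ifs
  · simp [observableSum, observable_replace hN]
  · simp

open scoped Classical in
theorem observableSum_dite_replaceRemove (hN : N ≠ 0) (s : LoopSeq d)
    {k r : Fin s.minRep.length} (hkr : k ≠ r) {p : Prop} (l : p → Loop d) (Q : Config Λ N) :
    observableSum Λ N (if h : k ≠ r ∧ p then {s.replaceRemove k r (l h.2)} else 0) Q =
      (if h : p then normalizedWilson Q (l h) else 0) *
        ∏ j ∈ (Finset.univ.erase k).erase r, normalizedWilson Q s.minRep[j] := by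
  by_cases h : p
  · simp [observableSum, observable_replaceRemove hN s hkr, hkr, h]
  · simp [h]

open scoped Classical in
theorem sum_observableSum_dite_replaceRemove (hN : N ≠ 0) (s : LoopSeq d)
    (k : Fin s.minRep.length)
    (l : ∀ r x y, Parallel s.minRep[k].path s.minRep[(r : Fin s.minRep.length)].path x y → Loop d)
    (Q : Config Λ N) :
    ∑ r, ∑ x, ∑ y, observableSum Λ N
        (if h : k ≠ r ∧ Parallel s.minRep[k].path s.minRep[r].path x y then
          {s.replaceRemove k r (l r x y h.2)} else 0) Q =
      ∑ r ∈ Finset.univ.erase k,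
        (∑ x, ∑ y, if h : Parallel s.minRep[k].path s.minRep[r].path x y then
          normalizedWilson Q (l r x y h) else 0) *
        ∏ j ∈ (Finset.univ.erase k).erase r, normalizedWilson Q s.minRep[j] := by
  rw [← Finset.sum_erase Finset.univ (a := k) (by simp)]
  refine Finset.sum_congr rfl fun r hr => ?_
  simp only [observableSum_dite_replaceRemove hN s (Finset.ne_of_mem_erase hr).symm (l r _ _),
    Finset.sum_mul]

/-! ### The master loop equation -/

theorem LoopSeq.length_eq_sum (s : LoopSeq d) :
    s.length = ∑ k : Fin s.minRep.length, s.minRep[k].length :=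
  (Fin.sum_univ_fun_getElem s.minRep Loop.length).symm

/-- The derivative of `observable Λ N s` in the direction `D`. -/
noncomputable def observableDeriv (s : LoopSeq d) (Q : Config Λ N) : ℝ :=
  ∑ k : Fin s.minRep.length, traceDeriv D s.minRep[k].path Q / N *
    ∏ j ∈ Finset.univ.erase k, normalizedWilson Q s.minRep[j]

/-- The second derivative of `observable Λ N s` in the direction `D`. -/
noncomputable def observableDerivTwo (s : LoopSeq d) (Q : Config Λ N) : ℝ :=
  ∑ k : Fin s.minRep.length,
    (traceDerivTwo D s.minRep[k].path Q / N *
        ∏ j ∈ Finset.univ.erase k, normalizedWilson Q s.minRep[j] +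
      traceDeriv D s.minRep[k].path Q / N *
        ∑ r ∈ Finset.univ.erase k, traceDeriv D s.minRep[r].path Q / N *
          ∏ j ∈ (Finset.univ.erase k).erase r, normalizedWilson Q s.minRep[j])

theorem hasLieDeriv_observableDeriv (s : LoopSeq d) :
    HasLieDeriv (flow D) (observableDeriv D s) (observableDerivTwo D s) :=
  HasLieDeriv.sum fun k _ => ((hasLieDeriv_traceDeriv D s.minRep[k].path).div_const N).mul
    (HasLieDeriv.prod fun j _ => hasLieDeriv_normalizedWilson D s.minRep[j])

theorem sum_traceDerivTwo_mul_prod (hN : N ≠ 0) (s : LoopSeq d)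
    (hs : ∀ l ∈ s.minRep, ∀ f ∈ l.path, f.InLattice Λ) (Q : Config Λ N) :
    ∑ D : Direction Λ N, ∑ k : Fin s.minRep.length, traceDerivTwo D s.minRep[k].path Q / N *
        ∏ j ∈ Finset.univ.erase k, normalizedWilson Q s.minRep[j] =
      2 * (-((N - 1) * s.length * observable Λ N s Q) +
        observableSum Λ N s.negTwistings Q - observableSum Λ N s.posTwistings Q +
        N * observableSum Λ N s.negSplittings Q - N * observableSum Λ N s.posSplittings Q) := by
  have component (k : Fin s.minRep.length) :=
    sum_traceDerivTwo_path Q s.minRep[k] (hs _ (List.getElem_mem _)) hN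
  have observable_eq (k : Fin s.minRep.length) : observable Λ N s Q =
      normalizedWilson Q s.minRep[k] *
        ∏ j ∈ Finset.univ.erase k, normalizedWilson Q s.minRep[j] := by
    rw [observable_eq_prod, ← Finset.mul_prod_erase _ _ (Finset.mem_univ k)]
  have length_mul_observable : s.length * observable Λ N s Q =
      ∑ k : Fin s.minRep.length, s.minRep[k].length * (normalizedWilson Q s.minRep[k] *
        ∏ j ∈ Finset.univ.erase k, normalizedWilson Q s.minRep[j]) := by
    simp only [← observable_eq, ← Finset.sum_mul, s.length_eq_sum, Nat.cast_sum]
  rw [Finset.sum_comm, mul_assoc, length_mul_observable]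
  simp only [← Finset.sum_mul, ← Finset.sum_div, component, LoopSeq.negTwistings,
    LoopSeq.posTwistings, LoopSeq.negSplittings, LoopSeq.posSplittings, map_sum,
    ContinuousMap.sum_apply, observableSum_dite_replace hN, List.map_cons, List.map_nil,
    List.prod_cons, List.prod_nil, mul_one]
  simp only [Finset.mul_sum (ι := Fin s.minRep.length),
    ← Finset.sum_add_distrib, ← Finset.sum_sub_distrib, ← Finset.sum_neg_distrib]
  exact Finset.sum_congr rfl fun k _ => by ring

theorem sum_traceDeriv_mul_sum_traceDeriv (hN : N ≠ 0) (s : LoopSeq d)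
    (hs : ∀ l ∈ s.minRep, ∀ f ∈ l.path, f.InLattice Λ) (Q : Config Λ N) :
    ∑ D : Direction Λ N, ∑ k : Fin s.minRep.length, traceDeriv D s.minRep[k].path Q / N *
        ∑ r ∈ Finset.univ.erase k, traceDeriv D s.minRep[r].path Q / N *
          ∏ j ∈ (Finset.univ.erase k).erase r, normalizedWilson Q s.minRep[j] =
      2 * (1 / N * observableSum Λ N s.negMergers Q -
        1 / N * observableSum Λ N s.posMergers Q) := by
  have pair (k r : Fin s.minRep.length) := sum_traceDeriv_mul_traceDeriv Q
    s.minRep[k].isClosed_path s.minRep[r].isClosed_path (hs _ (List.getElem_mem k.2)) hN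
  have expand : ∑ D : Direction Λ N, ∑ k : Fin s.minRep.length,
      traceDeriv D s.minRep[k].path Q / N *
        ∑ r ∈ Finset.univ.erase k, traceDeriv D s.minRep[r].path Q / N *
          ∏ j ∈ (Finset.univ.erase k).erase r, normalizedWilson Q s.minRep[j] =
      ∑ k : Fin s.minRep.length, ∑ r ∈ Finset.univ.erase k,
        (∑ D : Direction Λ N, traceDeriv D s.minRep[k].path Q * traceDeriv D s.minRep[r].path Q) /
          N ^ 2 * ∏ j ∈ (Finset.univ.erase k).erase r, normalizedWilson Q s.minRep[j] := by
    rw [Finset.sum_comm]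
    refine Finset.sum_congr rfl fun k _ => ?_
    simp only [Finset.mul_sum, Finset.sum_div, Finset.sum_mul]
    rw [Finset.sum_comm]
    refine Finset.sum_congr rfl fun r _ => Finset.sum_congr rfl fun D _ => ?_
    ring
  simp only [expand, pair, LoopSeq.negMergers, LoopSeq.posMergers, map_sum,
    ContinuousMap.sum_apply, fun k => sum_observableSum_dite_replaceRemove hN s k (fun r =>
      negMerge s.minRep[k].path s.minRep[r].path s.minRep[k].isClosed_path
        s.minRep[r].isClosed_path) Q, fun k => sum_observableSum_dite_replaceRemove hN s k (fun r =>
      posMerge s.minRep[k].path s.minRep[r].path s.minRep[k].isClosed_path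
        s.minRep[r].isClosed_path) Q]
  simp only [Finset.mul_sum (ι := Fin s.minRep.length),
    ← Finset.sum_sub_distrib (ι := Fin s.minRep.length)]
  refine Finset.sum_congr rfl fun k _ => Finset.sum_congr rfl fun r _ => ?_
  field_simp

theorem sum_observableDeriv_mul_actionDeriv (hN : N ≠ 0) (β : ℝ) (s : LoopSeq d)
    (hs : ∀ l ∈ s.minRep, ∀ f ∈ l.path, NeighborhoodIn Λ f) (Q : Config Λ N) :
    ∑ D : Direction Λ N, observableDeriv D s Q * actionDeriv D β Q =
      2 * (N * β * observableSum Λ N s.negDeformations Q -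
        N * β * observableSum Λ N s.posDeformations Q) := by
  have component (k : Fin s.minRep.length) := sum_traceDeriv_mul_sum_plaquettes Q
    s.minRep[k].isClosed_path (hs _ (List.getElem_mem k.2)) hN
  have expand : ∑ D : Direction Λ N, observableDeriv D s Q * actionDeriv D β Q =
      ∑ k : Fin s.minRep.length, β * (∑ D : Direction Λ N, traceDeriv D s.minRep[k].path Q *
          ∑ p ∈ posPlaquettesIn Λ, traceDeriv D p Q) *
        ∏ j ∈ Finset.univ.erase k, normalizedWilson Q s.minRep[j] := by
    simp only [observableDeriv, actionDeriv, Finset.sum_mul (s := Finset.univ)]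
    rw [Finset.sum_comm]
    refine Finset.sum_congr rfl fun k _ => ?_
    rw [Finset.mul_sum, Finset.sum_mul]
    refine Finset.sum_congr rfl fun D _ => ?_
    field_simp
  simp only [expand, component, LoopSeq.negDeformations, LoopSeq.posDeformations, map_sum,
    ContinuousMap.sum_apply, observableSum_dite_replace hN, List.map_cons, List.map_nil,
    List.prod_cons, List.prod_nil, mul_one, ← Finset.sum_mul]
  simp only [Finset.mul_sum (ι := Fin s.minRep.length),
    ← Finset.sum_sub_distrib (ι := Fin s.minRep.length)]
  exact Finset.sum_congr rfl fun k _ => by ring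

theorem sum_observableDerivTwo_add_mul_actionDeriv (hN : N ≠ 0) (β : ℝ) (s : LoopSeq d)
    (hs : ∀ l ∈ s.minRep, ∀ f ∈ l.path, NeighborhoodIn Λ f) (Q : Config Λ N) :
    ∑ D : Direction Λ N, (observableDerivTwo D s Q + observableDeriv D s Q * actionDeriv D β Q) =
      2 * (-((N - 1) * s.length * observable Λ N s Q) +
        observableSum Λ N s.negTwistings Q - observableSum Λ N s.posTwistings Q +
        N * observableSum Λ N s.negSplittings Q - N * observableSum Λ N s.posSplittings Q +
        1 / N * observableSum Λ N s.negMergers Q - 1 / N * observableSum Λ N s.posMergers Q +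
        N * β * observableSum Λ N s.negDeformations Q -
        N * β * observableSum Λ N s.posDeformations Q) := by
  have inLattice : ∀ l ∈ s.minRep, ∀ f ∈ l.path, f.InLattice Λ :=
    fun l hl f hf => (hs l hl f hf).inLattice
  simp only [observableDerivTwo, Finset.sum_add_distrib]
  rw [sum_traceDerivTwo_mul_prod hN s inLattice, sum_traceDeriv_mul_sum_traceDeriv hN s inLattice,
    sum_observableDeriv_mul_actionDeriv hN β s hs]
  ring

theorem expectation_length_smul_observable (hN : N ≠ 0) (β : ℝ) (s : LoopSeq d)
    (hs : ∀ l ∈ s.minRep, ∀ f ∈ l.path, NeighborhoodIn Λ f) :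
    expectation Λ N β (((N - 1) * s.length : ℝ) • observable Λ N s) =
      expectation Λ N β (observableSum Λ N s.negTwistings - observableSum Λ N s.posTwistings +
        (N : ℝ) • observableSum Λ N s.negSplittings - (N : ℝ) • observableSum Λ N s.posSplittings +
        (1 / N : ℝ) • observableSum Λ N s.negMergers -
        (1 / N : ℝ) • observableSum Λ N s.posMergers +
        (N * β) • observableSum Λ N s.negDeformations -
        (N * β) • observableSum Λ N s.posDeformations) := by
  refine (sub_eq_zero.1 ?_).symm
  rw [← map_sub]
  set residual : C(Config Λ N, ℝ) := _ - ((N - 1) * s.length : ℝ) • observable Λ N s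
  have residual_eq (Q : Config Λ N) : residual Q = 2⁻¹ * ∑ D : Direction Λ N,
      (observableDerivTwo D s Q + observableDeriv D s Q * actionDeriv D β Q) := by
    rw [sum_observableDerivTwo_add_mul_actionDeriv hN β s hs Q]
    simp only [residual, ContinuousMap.sub_apply, ContinuousMap.add_apply,
      ContinuousMap.smul_apply, smul_eq_mul]
    ring
  have integrable (D : Direction Λ N) : Integrable (fun Q => observableDerivTwo D s Q +
      observableDeriv D s Q * actionDeriv D β Q) (gaugeMeasure Λ N β) :=
    have h := hasLieDeriv_observableDeriv D s
    integrable_of_continuous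
      (h.continuous_deriv.add (h.continuous.mul (continuous_actionDeriv D β)))
  change ∫ Q, residual Q ∂gaugeMeasure Λ N β = 0
  simp only [residual_eq]
  rw [integral_const_mul, integral_finsetSum _ fun D _ => integrable D, Finset.sum_eq_zero
    fun D _ => integral_add_mul_actionDeriv_eq_zero (hasLieDeriv_observableDeriv D s) β, mul_zero]

end LatticeGauge

theorem mainTheorem2 (d : ℕ) (hd : 2 ≤ d) (Λ : Finset (Fin d → ℤ)) (hΛ : Λ.Nonempty)
    (N : ℕ) (hN : 2 ≤ N) (β : ℝ) (s : LatticeGauge.LoopSeq d) (hs : s ≠ LatticeGauge.LoopSeq.null d)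
    (hsΛ : ∀ l ∈ s.minRep, ∀ v ∈ l.vertices, ∀ w : Fin d → ℤ, ∑ i, |w i - v i| ≤ 1 → w ∈ Λ) :
    ((N : ℝ) - 1) * (s.length : ℝ) * LatticeGauge.phi Λ N β s =
      (s.negTwistings.map (LatticeGauge.phi Λ N β)).sum - (s.posTwistings.map (LatticeGauge.phi Λ N β)).sum
      + N * (s.negSplittings.map (LatticeGauge.phi Λ N β)).sum - N * (s.posSplittings.map (LatticeGauge.phi Λ N β)).sum
      + 1 / N * (s.negMergers.map (LatticeGauge.phi Λ N β)).sum - 1 / N * (s.posMergers.map (LatticeGauge.phi Λ N β)).sum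
      + N * β * (s.negDeformations.map (LatticeGauge.phi Λ N β)).sum
      - N * β * (s.posDeformations.map (LatticeGauge.phi Λ N β)).sum := by
  have N_ne_zero : N ≠ 0 := by omega
  have neighborhoodIn : ∀ l ∈ s.minRep, ∀ f ∈ l.path, LatticeGauge.NeighborhoodIn Λ f :=
    fun l hl f hf v hv =>
      hsΛ l hl v ⟨f, by rw [← l.coe_path]; exact Cycle.mem_coe_iff.2 hf, hv⟩
  have expectation_eq :=
    LatticeGauge.expectation_length_smul_observable N_ne_zero β s neighborhoodIn
  simpa only [map_add, map_sub, map_smul, smul_eq_mul, LatticeGauge.expectation_observable,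
    LatticeGauge.expectation_observableSum] using expectation_eq
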